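/- Let $n\ge 0$ and let $s_1,\dots,s_n$ be the adjacent transpositions generating $S_{n+1}$. The heap of a word $\mathsf w=\mathsf w_1\cdots\mathsf w_r$ in $s_1,\dots,s_n$ is the labeled poset on $\{1,\dots,r\}$ in which $j$ has label $\mathsf w_j$ (if $\mathsf w_j=s_c$, the entry $j$ lies in column $c$) and whose strict order is the transitive closure of the relation "$i<j$, and $\mathsf w_i,\mathsf w_j$ do not commute or are equal". Two entries $x<y$ of one column form a minimal pair if no other entry of that column lies between them; a distinct resolution of such a pair in column $c$ is a pair of entries, one in column $c-1$ and one in column $c+1$, both strictly between $x$ and $y$ in the heap. A commutativity class of $w\in S_{n+1}$ is an equivalence class of reduced expressions for $w$ under the moves $s_is_j\mapsto s_js_i$, $|i-j|\ge 2$; all its words have the same heap up to isomorphism of labeled posets. A braid cluster of length $2k+1$, $k\ge 1$, is a word $s_{i_1}\cdots s_{i_k}s_{i_{k+1}}s_{i_k}\cdots s_{i_1}$ such that for each $1\le p\le k$ there is a unique $q$ with $p<q\le k+1$ and $|i_p-i_q|=1$. A permutation $w$ is maximally clustered if it has a reduced expression $a_0c_1a_1c_2\cdots c_Ma_M$ ($M\ge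 0$), where each $a_j$ is a reduced word, each $c_j$ is a braid cluster of length $2m_j+1$, and $\sum_{j=1}^M m_j$ is the number of instances of the pattern $321$ in $w$. A heap has a braid cluster column decomposition if its set of columns $\{1,\dots,n\}$ can be partitioned, from left to right, into intervals $\tilde C_0,\tilde B_1,\tilde C_1,\dots,\tilde B_k,\tilde C_k$ ($k\ge 0$; the $\tilde C_i$ may be empty) such that (1) for each $\tilde B_i=[p,q]$ we have $p<q$, and the restriction of the heap to the columns in $\tilde B_i$ is the heap of the canonical braid cluster $s_ps_{p+1}\cdots s_{q-1}s_qs_{q-1}\cdots s_{p+1}s_p$; (2) every minimal pair of entries in any column belonging to some $\tilde C_i$ has a distinct resolution (the entries of the resolution may lie in any columns of the heap). Then every maximally clustered permutation $w\in S_{n+1}$ has a unique commutativity class whose heap has a braid cluster column decomposition. Conversely, if the heap of a word $\mathsf w$ in $s_1,\dots,s_n$ has a braid cluster column decomposition, then $\mathsf w$ is a reduced expression, and the permutation it expresses is maximally clustered. -/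

import Mathlib

/-! Words in the adjacent transpositions of the symmetric group on `n + 1` letters, their heaps,
braid clusters, maximally clustered permutations and braid cluster column decompositions.

The generators (and the columns of heaps) are indexed by `Fin n`, and the permuted letters by
`Fin (n + 1)`: the generator `i` interchanges the letters `i` and `i + 1`. -/

namespace MaxClustered

variable {n : ℕ}

/-- The adjacent transposition with index `i`. -/
def gen (i : Fin n) : Equiv.Perm (Fin (n + 1)) := Equiv.swap i.castSucc i.succ

/-- The permutation expressed by a word in the generators. -/
def wordProd (u : List (Fin n)) : Equiv.Perm (Fin (n + 1)) := (u.map gen).prod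

/-- A word is reduced if no shorter word expresses the same permutation. -/
def IsReduced (u : List (Fin n)) : Prop :=
  ∀ v : List (Fin n), wordProd v = wordProd u → u.length ≤ v.length

/-- `u` is a reduced expression for the permutation `w`. -/
def IsReducedExpr (u : List (Fin n)) (w : Equiv.Perm (Fin (n + 1))) : Prop :=
  IsReduced u ∧ wordProd u = w

/-- Two indices are adjacent (differ by exactly one); these are the pairs of distinct generators
that do not commute. -/
def Adjacent (a b : Fin n) : Prop := (a : ℕ) + 1 = b ∨ (b : ℕ) + 1 = a

/-! ### Commutativity classes -/

/-- A commuting move interchanges two neighbouring letters of a word whose indices differ by at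
least two. -/
def CommMove (u v : List (Fin n)) : Prop :=
  ∃ (l r : List (Fin n)) (a b : Fin n), ((a : ℕ) + 2 ≤ b ∨ (b : ℕ) + 2 ≤ a) ∧
    u = l ++ a :: b :: r ∧ v = l ++ b :: a :: r

/-- All words obtained from `u` by a sequence of commuting moves. -/
def commClass (u : List (Fin n)) : Set (List (Fin n)) :=
  {v | Relation.ReflTransGen CommMove u v}

/-- `C` is a commutativity class of (reduced expressions for) the permutation `w`. -/
def IsCommClassOf (C : Set (List (Fin n))) (w : Equiv.Perm (Fin (n + 1))) : Prop :=
  ∃ u, IsReducedExpr u w ∧ C = commClass u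

/-! ### Heaps -/

/-- The strict order of the heap of the word `u`, whose entries are the positions in `u`; the entry
`x` lies in column `u.get x`. It is the transitive closure of: `x` is before `y`, and their labels
are adjacent or equal. (For reduced words the relations between equal labels are implied by the
others.) -/
def HeapLT (u : List (Fin n)) : Fin u.length → Fin u.length → Prop :=
  Relation.TransGen fun x y => x < y ∧ (Adjacent (u.get x) (u.get y) ∨ u.get x = u.get y)

/-- `x < y` is a minimal pair of entries in one column of the heap of `u`: there is no other entry
of this column between them. -/
def IsMinimalPair (u : List (Fin n)) (x y : Fin u.length) : Prop :=
  u.get x = u.get y ∧ HeapLT u x y ∧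
    ¬ ∃ z, u.get z = u.get x ∧ HeapLT u x z ∧ HeapLT u z y

/-- The pair `x, y` of one column has a distinct resolution: two entries in distinct columns, both
strictly between `x` and `y` in the heap, whose labels do not commute with the label of `x`
and `y`. -/
def HasDistinctResolution (u : List (Fin n)) (x y : Fin u.length) : Prop :=
  ∃ z z' : Fin u.length, u.get z ≠ u.get z' ∧
    Adjacent (u.get z) (u.get x) ∧ Adjacent (u.get z') (u.get x) ∧
    HeapLT u x z ∧ HeapLT u z y ∧ HeapLT u x z' ∧ HeapLT u z' y

/-- The word `p, p + 1, …, q - 1, q, q - 1, …, p + 1, p`. -/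
def canonicalCluster (p q : Fin n) : List (Fin n) :=
  (List.finRange n).filter (fun i => p ≤ i ∧ i ≤ q) ++
    ((List.finRange n).filter (fun i => p ≤ i ∧ i < q)).reverse

/-- The heap of `u` restricted to the columns from `p` to `q` is isomorphic, as a labeled poset, to
the heap of the canonical form of a braid cluster on these columns. -/
def RestrictsToCanonicalCluster (u : List (Fin n)) (p q : Fin n) : Prop :=
  ∃ e : {x : Fin u.length // p ≤ u.get x ∧ u.get x ≤ q} ≃ Fin (canonicalCluster p q).length,
    (∀ x, (canonicalCluster p q).get (e x) = u.get x.1) ∧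
    ∀ x y, HeapLT (canonicalCluster p q) (e x) (e y) ↔ HeapLT u x.1 y.1

/-- The heap of `u` has a braid cluster column decomposition. The pairwise disjoint intervals
`[p i, q i]` are listed from left to right and carry the braid clusters; the (possibly empty)
intervals of columns before, between and after them are the remaining parts of the partition. -/
def HeapHasDecomposition (u : List (Fin n)) : Prop :=
  ∃ (k : ℕ) (p q : Fin k → Fin n),
    (∀ i, p i < q i) ∧
    (∀ i j, i < j → q i < p j) ∧
    (∀ i, RestrictsToCanonicalCluster u (p i) (q i)) ∧
    ∀ x y : Fin u.length, IsMinimalPair u x y →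
      (∀ i, ¬ (p i ≤ u.get x ∧ u.get x ≤ q i)) → HasDistinctResolution u x y

/-- The heap of the commutativity class `C` has a braid cluster column decomposition. The heap of
`C` is the heap of any of its words; up to isomorphism of labeled posets it does not depend on the
word. -/
def ClassHasDecomposition (C : Set (List (Fin n))) : Prop :=
  ∃ u ∈ C, HeapHasDecomposition u

/-! ### Maximally clustered permutations -/

/-- `c` is a braid cluster of length `2 * k + 1`: it is the word
`i 0, …, i (k - 1), i k, i (k - 1), …, i 0`, where `k` is positive and each letter before the middle
one is adjacent to exactly one of the letters after it, up to the middle one. -/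
def IsBraidCluster (k : ℕ) (c : List (Fin n)) : Prop :=
  1 ≤ k ∧ ∃ i : Fin (k + 1) → Fin n,
    (∀ p, p < Fin.last k → ∃! q, p < q ∧ Adjacent (i p) (i q)) ∧
    c = List.ofFn i ++ (List.ofFn fun j : Fin k => i j.castSucc).reverse

/-- The number of instances of the pattern `321` in `w`. -/
def num321 (w : Equiv.Perm (Fin (n + 1))) : ℕ :=
  Fintype.card {t : Fin (n + 1) × Fin (n + 1) × Fin (n + 1) //
    t.1 < t.2.1 ∧ t.2.1 < t.2.2 ∧ w t.2.2 < w t.2.1 ∧ w t.2.1 < w t.1}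

/-- `w` is maximally clustered: it has a reduced expression `a 0, c 0, a 1, …, c (M - 1), a M` in
which each `a j` is reduced, each `c j` is a braid cluster of length `2 * m j + 1`, and the sum of
the `m j` is the number of instances of the pattern `321` in `w`. -/
def IsMaximallyClustered (w : Equiv.Perm (Fin (n + 1))) : Prop :=
  ∃ (M : ℕ) (a : Fin (M + 1) → List (Fin n)) (c : Fin M → List (Fin n)) (m : Fin M → ℕ),
    (∀ j, IsReduced (a j)) ∧
    (∀ j, IsBraidCluster (m j) (c j)) ∧
    IsReducedExpr (a 0 ++ (List.ofFn fun j : Fin M => c j ++ a j.succ).flatten) w ∧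
    num321 w = ∑ j, m j

end MaxClustered

/-!
Read a word from the right as a braid-like diagram of strings: the letter `b` interchanges the
strings at levels `b` and `b + 1`, a string entering at level `i` ends at level `w i`, and in a
reduced word the crossings are the inversions of `w`. Strings that cross pairwise in threes are the
instances of the pattern 321. The proof compares three conditions, none of which mentions clusters.

* `Good u`: the word is reduced, and of three strings `x < y < z` that cross pairwise, `x` and `y`
  always cross before `y` and `z`. Each permutation has a good word, built by splitting off the
  lowest descent (`exists_good`). All good words of a permutation are related by commuting moves
  (`Good.commEquiv`): two adjacent letters `a`, `a + 1` cannot both be the last crossing of a good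
  word, as this would give three strings crossing in both orders.
* `Star w`: the middle entry of an instance of 321 is a fixed point of `w` and is the middle of no
  other instance. This is equivalent to `w` being maximally clustered. In one direction
  (`IsMaximallyClustered.star`), a cluster of length `2 * m + 1` is a reduced word for a
  transposition of two strings with at least `m` strings between them; this gives `m` instances of
  321, and those from all clusters together, no two of which share their first two or last two
  entries, exhaust the instances. In the other (`Star.exists_clustered`), crossings not involving
  middles are split off one at a time; when none is left, two strings can be found with only middles
  between them, and a canonical braid cluster splits off.
* `Nested u`: a local condition on columns, which holds exactly if the heap of `u` has a braid
  cluster column decomposition (`HeapHasDecomposition.nested`, `Nested.heapHasDecomposition`): the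
  clusters are the maximal runs of columns `c` having two consecutive entries with no entry of
  column `c - 1` between them.

Finally, `Nested u` holds if and only if `Good u` and `Star (wordProd u)` do. With nested columns, a
string that has moved up can only move up again, so each string is monotone or goes down and up once
(`Nested.good_and_state`); the strings of the second kind are the middles. Conversely, in a good word
a column entry missing between two consecutive entries of a column forces a wrongly ordered triple
or a middle (`Good.nested`).
-/

namespace MaxClustered

variable {n : ℕ}

/-! ### Strings of a word -/

theorem gen_val (b : Fin n) (x : Fin (n + 1)) : ((gen b x : Fin (n + 1)) : ℕ) =
    if (x : ℕ) = b then (b : ℕ) + 1 else if (x : ℕ) = b + 1 then (b : ℕ) else x := by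
  unfold gen
  rw [Equiv.swap_apply_def]
  simp only [Fin.ext_iff, Fin.val_castSucc, Fin.val_succ]
  split_ifs <;> simp

theorem gen_mul_self (b : Fin n) : gen b * gen b = 1 := Equiv.swap_mul_self _ _

theorem wordProd_nil : wordProd ([] : List (Fin n)) = 1 := rfl

theorem wordProd_cons (b : Fin n) (u : List (Fin n)) :
    wordProd (b :: u) = gen b * wordProd u := by
  simp [wordProd]

theorem wordProd_append (u v : List (Fin n)) :
    wordProd (u ++ v) = wordProd u * wordProd v := by
  simp [wordProd]

/-- The level reached by the string that enters the word `u` from the right at level `i`. -/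
def pos (u : List (Fin n)) (i : Fin (n + 1)) : ℕ := (wordProd u i : ℕ)

@[simp] theorem pos_nil (i : Fin (n + 1)) : pos ([] : List (Fin n)) i = i := rfl

theorem pos_cons (b : Fin n) (u : List (Fin n)) (i : Fin (n + 1)) : pos (b :: u) i =
    if pos u i = b then (b : ℕ) + 1 else if pos u i = b + 1 then (b : ℕ) else pos u i := by
  unfold pos
  rw [wordProd_cons, Equiv.Perm.mul_apply, gen_val]

theorem pos_append (u v : List (Fin n)) (i : Fin (n + 1)) :
    pos (u ++ v) i = pos u (wordProd v i) := by
  unfold pos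
  rw [wordProd_append, Equiv.Perm.mul_apply]

theorem pos_inj {u : List (Fin n)} {i j : Fin (n + 1)} : pos u i = pos u j ↔ i = j := by
  unfold pos
  rw [← Fin.ext_iff, (wordProd u).injective.eq_iff]

theorem exists_pos (u : List (Fin n)) {m : ℕ} (hm : m ≤ n) : ∃ i, pos u i = m :=
  ⟨(wordProd u)⁻¹ ⟨m, by omega⟩, by simp [pos]⟩

/-- A string stays at its level while no letter acts on this level. -/
theorem pos_append_of_forall {v u : List (Fin n)} {i : Fin (n + 1)} {c : ℕ}
    (hc : pos u i = c) (hv : ∀ d ∈ v, (d : ℕ) ≠ c ∧ (d : ℕ) + 1 ≠ c) : pos (v ++ u) i = c := by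
  induction v with
  | nil => simpa using hc
  | cons b v ih =>
    rw [List.cons_append, pos_cons, ih fun d hd => hv d (List.mem_cons_of_mem _ hd)]
    have := hv b List.mem_cons_self
    split_ifs <;> omega

/-- A string does not get past column `c` while no letter of this column acts. -/
theorem pos_append_le_iff {v u : List (Fin n)} {c : ℕ} (hv : ∀ d ∈ v, (d : ℕ) ≠ c)
    (i : Fin (n + 1)) : pos (v ++ u) i ≤ c ↔ pos u i ≤ c := by
  induction v with
  | nil => simp
  | cons b v ih =>
    rw [← ih fun d h => hv d (List.mem_cons_of_mem _ h), List.cons_append, pos_cons]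
    have := hv b List.mem_cons_self
    split_ifs <;> omega

/-! ### Reduced words and inversions -/

/-- Each letter, read from the right, makes two strings cross that have not crossed before. -/
def RedWord : List (Fin n) → Prop
  | [] => True
  | b :: u => RedWord u ∧ ∀ i j, pos u i = b → pos u j = b + 1 → i < j

theorem RedWord.of_append {v u : List (Fin n)} (h : RedWord (v ++ u)) : RedWord u := by
  induction v with
  | nil => exact h
  | cons b v ih => exact ih h.1

/-- Strings that have crossed in a reduced word never uncross. -/
theorem RedWord.pos_lt {v u : List (Fin n)} (h : RedWord (v ++ u)) {i j : Fin (n + 1)}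
    (hij : i < j) (hlt : pos u j < pos u i) : pos (v ++ u) j < pos (v ++ u) i := by
  induction v with
  | nil => exact hlt
  | cons b v ih =>
    have h1 := ih h.1
    have h2 : pos (v ++ u) j = b → pos (v ++ u) i = b + 1 → j < i := h.2 j i
    rw [List.cons_append, pos_cons, pos_cons]
    rw [Fin.lt_def] at h2 hij
    split_ifs <;> omega

/-- The inversions of a permutation, as pairs of positions. -/
def invSet (w : Equiv.Perm (Fin (n + 1))) : Finset (Fin (n + 1) × Fin (n + 1)) :=
  Finset.univ.filter fun x => x.1 < x.2 ∧ w x.2 < w x.1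

theorem mem_invSet {w : Equiv.Perm (Fin (n + 1))} {i j : Fin (n + 1)} :
    (i, j) ∈ invSet w ↔ i < j ∧ w j < w i := by
  simp [invSet]

theorem card_invSet_gen_mul {w : Equiv.Perm (Fin (n + 1))} {b : Fin n}
    (h : w⁻¹ b.castSucc < w⁻¹ b.succ) :
    (invSet (gen b * w)).card = (invSet w).card + 1 := by
  have key : invSet (gen b * w) = insert (w⁻¹ b.castSucc, w⁻¹ b.succ) (invSet w) := by
    ext ⟨i, j⟩
    rw [mem_invSet, Finset.mem_insert, mem_invSet, Prod.mk.injEq, Equiv.Perm.mul_apply,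
      Equiv.Perm.mul_apply, Equiv.Perm.eq_inv_iff_eq, Equiv.Perm.eq_inv_iff_eq]
    have hi : ((w i : Fin (n + 1)) : ℕ) = b → i = w⁻¹ b.castSucc := fun e => by
      rw [Equiv.Perm.eq_inv_iff_eq]; ext; simpa using e
    have hj : ((w i : Fin (n + 1)) : ℕ) = b + 1 → i = w⁻¹ b.succ := fun e => by
      rw [Equiv.Perm.eq_inv_iff_eq]; ext; simpa using e
    have hi' : ((w j : Fin (n + 1)) : ℕ) = b → j = w⁻¹ b.castSucc := fun e => by
      rw [Equiv.Perm.eq_inv_iff_eq]; ext; simpa using e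
    have hj' : ((w j : Fin (n + 1)) : ℕ) = b + 1 → j = w⁻¹ b.succ := fun e => by
      rw [Equiv.Perm.eq_inv_iff_eq]; ext; simpa using e
    rw [Fin.lt_def, Fin.lt_def, Fin.lt_def, gen_val, gen_val]
    simp only [Fin.ext_iff, Fin.val_castSucc, Fin.val_succ] at *
    rw [Fin.lt_def] at h
    constructor
    · rintro ⟨h1, h2⟩
      split_ifs at h2 <;> omega
    · rintro (⟨h1, h2⟩ | ⟨h1, h2⟩)
      · have e1 := hi h1
        have e2 := hj' h2
        refine ⟨by omega, ?_⟩
        split_ifs <;> omega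
      · refine ⟨h1, ?_⟩
        split_ifs <;> omega
  rw [key, Finset.card_insert_of_notMem]
  rw [mem_invSet]
  simp only [Equiv.Perm.inv_def, Equiv.apply_symm_apply, not_and, not_lt]
  exact fun _ => Fin.castSucc_lt_succ.le

theorem card_invSet_gen_mul_add {w : Equiv.Perm (Fin (n + 1))} {b : Fin n}
    (h : w⁻¹ b.succ < w⁻¹ b.castSucc) :
    (invSet (gen b * w)).card + 1 = (invSet w).card := by
  have h' : (gen b * w)⁻¹ b.castSucc < (gen b * w)⁻¹ b.succ := by
    simpa [mul_inv_rev, gen, Equiv.Perm.mul_apply] using h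
  have := card_invSet_gen_mul h'
  rw [← mul_assoc, gen_mul_self, one_mul] at this
  exact this.symm

theorem pos_eq_iff {u : List (Fin n)} {i x : Fin (n + 1)} :
    pos u i = x ↔ i = (wordProd u)⁻¹ x := by
  rw [Equiv.Perm.eq_inv_iff_eq, Fin.ext_iff]; rfl

theorem redWord_cons_iff {b : Fin n} {u : List (Fin n)} : RedWord (b :: u) ↔
    RedWord u ∧ (wordProd u)⁻¹ b.castSucc < (wordProd u)⁻¹ b.succ := by
  refine and_congr_right fun _ => ⟨fun h => h _ _ ?_ ?_, fun h i j hi hj => ?_⟩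
  · simp [pos]
  · simp [pos]
  · have e1 := (pos_eq_iff (x := b.castSucc)).1 hi
    have e2 := (pos_eq_iff (x := b.succ)).1 hj
    rwa [e1, e2]

theorem card_invSet_one : (invSet (1 : Equiv.Perm (Fin (n + 1)))).card = 0 := by
  rw [Finset.card_eq_zero, invSet, Finset.filter_eq_empty_iff]
  rintro ⟨i, j⟩ -
  simpa using fun h => h.le

theorem card_invSet_le_length (u : List (Fin n)) : (invSet (wordProd u)).card ≤ u.length := by
  induction u with
  | nil => simp [wordProd_nil, card_invSet_one]
  | cons b u ih =>
    rw [wordProd_cons, List.length_cons]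
    rcases lt_trichotomy ((wordProd u)⁻¹ b.castSucc) ((wordProd u)⁻¹ b.succ) with h | h | h
    · rw [card_invSet_gen_mul h]; omega
    · exact absurd ((wordProd u)⁻¹.injective h) (Fin.castSucc_lt_succ.ne)
    · have := card_invSet_gen_mul_add h; omega

theorem redWord_iff_length {u : List (Fin n)} :
    RedWord u ↔ u.length = (invSet (wordProd u)).card := by
  induction u with
  | nil => simp [RedWord, wordProd_nil, card_invSet_one]
  | cons b u ih =>
    rw [redWord_cons_iff, ih, wordProd_cons, List.length_cons]
    have := card_invSet_le_length u
    rcases lt_trichotomy ((wordProd u)⁻¹ b.castSucc) ((wordProd u)⁻¹ b.succ) with h | h | h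
    · rw [card_invSet_gen_mul h]; exact ⟨fun h' => by omega, fun h' => ⟨by omega, h⟩⟩
    · exact absurd ((wordProd u)⁻¹.injective h) (Fin.castSucc_lt_succ.ne)
    · have := card_invSet_gen_mul_add h
      exact ⟨fun h' => absurd h'.2 h.le.not_gt, fun h' => by omega⟩

theorem RedWord.isReduced {u : List (Fin n)} (h : RedWord u) : IsReduced u := fun v hv => by
  rw [redWord_iff_length.1 h, ← hv]
  exact card_invSet_le_length v

theorem IsReduced.of_append {l u r : List (Fin n)} (h : IsReduced (l ++ u ++ r)) :
    IsReduced u := fun v hv => by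
  have := h (l ++ v ++ r) (by simp only [wordProd_append, hv])
  simp only [List.length_append] at this
  omega

/-! ### Words in which the lower crossings of each triple come first -/

/-- A reduced word in which, whenever three strings `x < y < z` cross pairwise, `x` and `y` cross
before `y` and `z` do (reading from the right): at a crossing of `i < j`, no string `k > j` lies
below. -/
def Good : List (Fin n) → Prop
  | [] => True
  | b :: u => Good u ∧ ∀ i j, pos u i = b → pos u j = b + 1 → i < j ∧ ∀ k, j < k → (b : ℕ) < pos u k

theorem Good.redWord {u : List (Fin n)} (h : Good u) : RedWord u := by
  induction u with
  | nil => trivial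
  | cons b u ih => exact ⟨ih h.1, fun i j hi hj => (h.2 i j hi hj).1⟩

/-- Splitting off the lowest descent of `w⁻¹` again and again yields a good word. -/
theorem exists_good (w : Equiv.Perm (Fin (n + 1))) : ∃ u, Good u ∧ wordProd u = w := by
  induction hN : (invSet w).card using Nat.strong_induction_on generalizing w with
  | _ N ih =>
    by_cases hd : ∃ b : Fin n, w⁻¹ b.succ < w⁻¹ b.castSucc
    · -- the lowest descent of `w⁻¹`
      classical
      obtain ⟨b, hb, hmin⟩ : ∃ b : Fin n, w⁻¹ b.succ < w⁻¹ b.castSucc ∧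
          ∀ c < b, ¬ w⁻¹ c.succ < w⁻¹ c.castSucc := by
        obtain ⟨b, hb, hm⟩ := (Finset.univ.filter fun b : Fin n =>
          w⁻¹ b.succ < w⁻¹ b.castSucc).exists_minimal (by simpa [Finset.Nonempty] using hd)
        refine ⟨b, by simpa using hb, fun c hc h => ?_⟩
        exact absurd (hm (by simpa using h) hc.le) hc.not_ge
      have hmono : ∀ c : Fin (n + 1), c ≤ b.castSucc → w⁻¹ c ≤ w⁻¹ b.castSucc := by
        have : ∀ m (hm : m ≤ (b : ℕ)), w⁻¹ ⟨(b : ℕ) - m, by omega⟩ ≤ w⁻¹ b.castSucc := by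
          intro m
          induction m with
          | zero => intro _; exact le_of_eq (by congr 1)
          | succ m ihm =>
            intro hm
            refine le_trans ?_ (ihm (by omega))
            have := hmin ⟨(b : ℕ) - (m + 1), by omega⟩ (by rw [Fin.lt_def]; simp; omega)
            rw [not_lt] at this
            convert this using 2
            · rfl
            · rw [Fin.ext_iff]
              change (b : ℕ) - m = (b : ℕ) - (m + 1) + 1
              omega
        intro c hc
        rw [Fin.le_def, Fin.val_castSucc] at hc
        convert this ((b : ℕ) - c) (by omega) using 2
        simp only [Fin.ext_iff]; omega
      have hlen := card_invSet_gen_mul_add hb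
      obtain ⟨u, hu, huw⟩ := ih _ (by omega) (gen b * w) rfl
      refine ⟨b :: u, ⟨hu, fun i j hi hj => ?_⟩, by
        rw [wordProd_cons, huw, ← mul_assoc, gen_mul_self, one_mul]⟩
      have e1 := (pos_eq_iff (x := b.castSucc)).1 hi
      have e2 := (pos_eq_iff (x := b.succ)).1 hj
      have f1 : i = w⁻¹ b.succ := by
        rw [e1, huw]; simp [mul_inv_rev, gen, Equiv.Perm.mul_apply]
      have f2 : j = w⁻¹ b.castSucc := by
        rw [e2, huw]; simp [mul_inv_rev, gen, Equiv.Perm.mul_apply]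
      refine ⟨by rw [f1, f2]; exact hb, fun k hk => ?_⟩
      by_contra hcon
      have hk1 : pos (b :: u) k = w k := by
        rw [pos, wordProd_cons, huw, ← mul_assoc, gen_mul_self, one_mul]
      have hne : pos u k ≠ b := by
        rw [← hi, Ne, pos_inj]; rintro rfl; rw [f1, f2] at hk; exact absurd hk hb.not_gt
      rw [pos_cons, if_neg hne, if_neg (by omega)] at hk1
      have := hmono (w k) (by rw [Fin.le_def, Fin.val_castSucc]; omega)
      rw [Equiv.Perm.inv_def, Equiv.symm_apply_apply, ← Equiv.Perm.inv_def, ← f2] at this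
      exact absurd hk this.not_gt
    · refine ⟨[], trivial, ?_⟩
      have hm : StrictMono (w⁻¹ : Equiv.Perm (Fin (n + 1))) := by
        rw [Fin.strictMono_iff_lt_succ]
        intro i
        push Not at hd
        exact lt_of_le_of_ne (hd i) fun h => absurd (w⁻¹.injective h) Fin.castSucc_lt_succ.ne
      have h1 : ∀ x, w⁻¹ x = x := fun x => by
        have := Subsingleton.elim (hm.orderIsoOfSurjective _ w⁻¹.surjective)
          (OrderIso.refl (Fin (n + 1)))
        exact congrArg (fun f : Fin (n + 1) ≃o Fin (n + 1) => f x) this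
      have h2 : w⁻¹ = 1 := Equiv.ext h1
      rw [wordProd_nil, inv_eq_one.1 h2]

theorem IsReduced.redWord {u : List (Fin n)} (h : IsReduced u) : RedWord u := by
  obtain ⟨v, hv, hvu⟩ := exists_good (wordProd u)
  have h1 := h v hvu
  rw [redWord_iff_length.1 hv.redWord, hvu] at h1
  exact redWord_iff_length.2 (le_antisymm h1 (card_invSet_le_length u))

/-! ### Uniqueness of the commutativity class of good words -/

theorem CommMove.symm {u v : List (Fin n)} (h : CommMove u v) : CommMove v u := by
  obtain ⟨l, r, a, b, hab, rfl, rfl⟩ := h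
  exact ⟨l, r, b, a, hab.symm, rfl, rfl⟩

theorem commEquiv_symm {u v : List (Fin n)} (h : Relation.ReflTransGen CommMove u v) :
    Relation.ReflTransGen CommMove v u := by
  induction h with
  | refl => rfl
  | tail _ h ih => exact ih.head h.symm

theorem commClass_eq {u v : List (Fin n)} (h : Relation.ReflTransGen CommMove u v) :
    commClass u = commClass v :=
  Set.ext fun _ => ⟨fun hx => (commEquiv_symm h).trans hx, fun hx => h.trans hx⟩

theorem commEquiv_cons (c : Fin n) {u v : List (Fin n)} (h : Relation.ReflTransGen CommMove u v) :
    Relation.ReflTransGen CommMove (c :: u) (c :: v) := by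
  refine Relation.ReflTransGen.lift (c :: ·) (fun x y hxy => ?_) _ _ h
  obtain ⟨l, r, a, b, hab, rfl, rfl⟩ := hxy
  exact ⟨c :: l, r, a, b, hab, rfl, rfl⟩

theorem pos_swap {a b : Fin n} (hab : (a : ℕ) + 2 ≤ b ∨ (b : ℕ) + 2 ≤ a) (r : List (Fin n))
    (i : Fin (n + 1)) : pos (a :: b :: r) i = pos (b :: a :: r) i := by
  simp only [pos_cons]
  split_ifs <;> omega

theorem wordProd_eq_of_pos {u v : List (Fin n)} (h : ∀ i, pos u i = pos v i) :
    wordProd u = wordProd v :=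
  Equiv.ext fun i => Fin.ext (h i)

theorem pos_congr {u v : List (Fin n)} (h : wordProd u = wordProd v) (i : Fin (n + 1)) :
    pos u i = pos v i := by rw [pos, h]; rfl

theorem CommMove.wordProd_eq {u v : List (Fin n)} (h : CommMove u v) :
    wordProd u = wordProd v := by
  obtain ⟨l, r, a, b, hab, rfl, rfl⟩ := h
  rw [wordProd_append, wordProd_append, wordProd_eq_of_pos (pos_swap hab r)]

theorem commEquiv_wordProd {u v : List (Fin n)} (h : Relation.ReflTransGen CommMove u v) :
    wordProd u = wordProd v := by
  induction h with
  | refl => rfl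
  | tail _ h ih => rw [ih, h.wordProd_eq]

theorem Good.swap {a b : Fin n} (hab : (a : ℕ) + 2 ≤ b ∨ (b : ℕ) + 2 ≤ a) {r : List (Fin n)}
    (h : Good (a :: b :: r)) : Good (b :: a :: r) := by
  obtain ⟨⟨hr, hb⟩, ha⟩ := h
  refine ⟨⟨hr, fun i j hi hj => ?_⟩, fun i j hi hj => ?_⟩
  · have := ha i j (by rw [pos_cons]; split_ifs <;> omega) (by rw [pos_cons]; split_ifs <;> omega)
    refine ⟨this.1, fun k hk => ?_⟩
    have := this.2 k hk
    rw [pos_cons] at this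
    split_ifs at this <;> omega
  · rw [pos_cons] at hi hj
    have := hb i j (by split_ifs at hi <;> omega) (by split_ifs at hj <;> omega)
    refine ⟨this.1, fun k hk => ?_⟩
    have := this.2 k hk
    rw [pos_cons]
    split_ifs <;> omega

theorem Good.append_congr {l x y : List (Fin n)} (hxy : Good x → Good y)
    (he : wordProd x = wordProd y) (h : Good (l ++ x)) : Good (l ++ y) := by
  induction l with
  | nil => exact hxy h
  | cons b l ih =>
    refine ⟨ih h.1, ?_⟩
    have he' : wordProd (l ++ x) = wordProd (l ++ y) := by rw [wordProd_append, wordProd_append, he]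
    have := h.2
    simp only [List.append_eq, pos_congr he'] at this
    exact this

theorem Good.of_commEquiv {u v : List (Fin n)} (hu : Good u)
    (h : Relation.ReflTransGen CommMove u v) : Good v := by
  induction h with
  | refl => exact hu
  | tail _ h ih =>
    obtain ⟨l, r, a, b, hab, rfl, rfl⟩ := h
    exact Good.append_congr (Good.swap hab) (wordProd_eq_of_pos (pos_swap hab r)) ih

/-- The letter `b` can be the last crossing of a good word for the same permutation as `u`. -/
def GoodDescent (u : List (Fin n)) (b : Fin n) : Prop :=
  ∀ i j, pos u i = b + 1 → pos u j = b → i < j ∧ ∀ k, j < k → (b : ℕ) < pos u k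

theorem Good.goodDescent {b : Fin n} {u : List (Fin n)} (h : Good (b :: u)) :
    GoodDescent (b :: u) b := by
  intro i j hi hj
  rw [pos_cons] at hi hj
  have hj' : pos u j = b + 1 := by split_ifs at hj <;> omega
  have := h.2 i j (by split_ifs at hi <;> omega) hj'
  refine ⟨this.1, fun k hk => ?_⟩
  have h1 := this.2 k hk
  have h2 : pos u k ≠ b + 1 := by rw [← hj', Ne, pos_inj]; exact hk.ne'
  rw [pos_cons]
  split_ifs <;> omega

theorem not_goodDescent_of_adjacent {u : List (Fin n)} {a b : Fin n} (hab : (a : ℕ) + 1 = b)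
    (ha : GoodDescent u a) (hb : GoodDescent u b) : False := by
  obtain ⟨i, hi⟩ := exists_pos u (m := a) (by omega)
  obtain ⟨j, hj⟩ := exists_pos u (m := a + 1) (by omega)
  obtain ⟨k, hk⟩ := exists_pos u (m := a + 2) (by omega)
  have h1 := (ha j i hj hi).1
  have h2 := (hb k j (by omega) (by omega)).2 i h1
  omega

/-- A possible last crossing of a good word can be moved to its front by commuting moves. -/
theorem Good.exists_cons {u : List (Fin n)} (hu : Good u) {b : Fin n} (hb : GoodDescent u b) :
    ∃ v, Relation.ReflTransGen CommMove u (b :: v) := by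
  induction u with
  | nil =>
    have := (hb b.succ b.castSucc (by simp) (by simp)).1
    exact absurd this Fin.castSucc_lt_succ.not_gt
  | cons a u ih =>
    rcases eq_or_ne a b with rfl | hne
    · exact ⟨u, .refl⟩
    · have hne' : (a : ℕ) ≠ b := fun h => hne (Fin.ext h)
      by_cases hab : (a : ℕ) + 2 ≤ b ∨ (b : ℕ) + 2 ≤ a
      · obtain ⟨v, hv⟩ := ih hu.1 (by
          intro i j hi hj
          have := hb i j (by rw [pos_cons]; split_ifs <;> omega)
            (by rw [pos_cons]; split_ifs <;> omega)
          refine ⟨this.1, fun k hk => ?_⟩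
          have := this.2 k hk
          rw [pos_cons] at this
          split_ifs at this <;> omega)
        exact ⟨a :: v, (commEquiv_cons a hv).tail ⟨[], v, a, b, hab, rfl, rfl⟩⟩
      · exfalso
        rcases Nat.lt_or_ge (a : ℕ) b with h | h
        · exact not_goodDescent_of_adjacent (by omega) hu.goodDescent hb
        · exact not_goodDescent_of_adjacent (by omega) hb hu.goodDescent

/-- A permutation has only one commutativity class of good words. -/
theorem Good.commEquiv {u v : List (Fin n)} (hu : Good u) (hv : Good v)
    (h : wordProd u = wordProd v) : Relation.ReflTransGen CommMove u v := by
  induction u generalizing v with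
  | nil =>
    have h1 := redWord_iff_length.1 hv.redWord
    rw [← h, wordProd_nil, card_invSet_one, List.length_eq_zero_iff] at h1
    rw [h1]
  | cons b u ih =>
    have hd : GoodDescent v b := by
      have := hu.goodDescent
      simpa only [GoodDescent, pos_congr h] using this
    obtain ⟨v', hv'⟩ := hv.exists_cons hd
    have hg := hv.of_commEquiv hv'
    have he := h.trans (commEquiv_wordProd hv')
    rw [wordProd_cons, wordProd_cons, mul_right_inj] at he
    exact (commEquiv_cons b (ih hu.1 hg.1 he)).trans (commEquiv_symm hv')

/-! ### Middles of 321-patterns, and words with nested columns -/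

/-- Each middle entry of an instance of the pattern 321 is a fixed point, and belongs to only one
instance as the middle entry. (Equivalently, the patterns 3421, 4312 and 4321 are avoided.) -/
def Star (w : Equiv.Perm (Fin (n + 1))) : Prop :=
  ∀ h i k, h < i → i < k → w i < w h → w k < w i →
    w i = i ∧ (∀ h' < i, w i < w h' → h' = h) ∧ ∀ k' > i, w k' < w i → k' = k

theorem star_wordProd_iff {u : List (Fin n)} : Star (wordProd u) ↔
    ∀ h i k, h < i → i < k → pos u i < pos u h → pos u k < pos u i →
      pos u i = i ∧ (∀ h' < i, pos u i < pos u h' → h' = h) ∧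
        ∀ k' > i, pos u k' < pos u i → k' = k := by
  simp only [Star, pos, Fin.lt_def, Fin.ext_iff, gt_iff_lt]

/-- Between two consecutive entries of column `c` there is an entry of column `c + 1`; and if there
is none of column `c - 1`, then all entries of column `c + 1` are there, and column `c` has no
further entries. -/
def Nested (u : List (Fin n)) : Prop :=
  ∀ (v₁ : List (Fin n)) (c : Fin n) (v₂ v₃ : List (Fin n)), u = v₁ ++ c :: (v₂ ++ c :: v₃) → c ∉ v₂ →
    (∃ d ∈ v₂, (d : ℕ) = c + 1) ∧
      ((∃ d ∈ v₂, (d : ℕ) + 1 = c) ∨ ∀ d, d ∈ v₁ ∨ d ∈ v₃ → (d : ℕ) ≠ c ∧ (d : ℕ) ≠ c + 1)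

theorem Nested.of_cons {b : Fin n} {u : List (Fin n)} (h : Nested (b :: u)) : Nested u := by
  intro v₁ c v₂ v₃ hu hc
  obtain ⟨h1, h2⟩ := h (b :: v₁) c v₂ v₃ (by rw [hu]; rfl) hc
  exact ⟨h1, h2.imp_right fun h d hd => h d (hd.imp_left (List.mem_cons_of_mem _))⟩

/-- The possible histories of the string `i` in a word with nested columns: it has never moved and
has crossed no other string; or it has moved up last, and either has crossed only larger strings or
is back at its start, having crossed at most one smaller and one larger string; or it has moved down
last, and has crossed only smaller strings. -/
def StringState (u : List (Fin n)) (i : Fin (n + 1)) : Prop :=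
  (pos u i = i ∧ (∀ h < i, pos u h < pos u i) ∧ ∀ k > i, pos u i < pos u k) ∨
  (∃ (v : List (Fin n)) (d : Fin n) (r : List (Fin n)), u = v ++ d :: r ∧ (d : ℕ) + 1 = pos u i ∧
    (∀ e ∈ v, (e : ℕ) ≠ pos u i ∧ (e : ℕ) + 1 ≠ pos u i) ∧
    ((i < pos u i ∧ ∀ h < i, pos u h < pos u i) ∨
      (pos u i = i ∧ (∃ h₀, ∀ h < i, pos u i < pos u h → h = h₀) ∧
        (∃ k₀, ∀ k > i, pos u k < pos u i → k = k₀) ∧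
        ∃ v₂ v₃ : List (Fin n), r = v₂ ++ d :: v₃ ∧ d ∉ v₂ ∧ ∀ e ∈ v₂, (e : ℕ) + 1 ≠ d))) ∨
  (∃ (v : List (Fin n)) (d : Fin n) (r : List (Fin n)), u = v ++ d :: r ∧ (d : ℕ) = pos u i ∧
    (∀ e ∈ v, (e : ℕ) ≠ pos u i ∧ (e : ℕ) + 1 ≠ pos u i) ∧
    pos u i < i ∧ ∀ k > i, pos u i < pos u k)

theorem StringState.cons {b : Fin n} {u : List (Fin n)} {i : Fin (n + 1)} (h : StringState u i)
    (h1 : pos u i ≠ b) (h2 : pos u i ≠ b + 1) : StringState (b :: u) i := by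
  have hi : pos (b :: u) i = pos u i := by rw [pos_cons, if_neg h1, if_neg h2]
  have hlt : ∀ k, pos (b :: u) k < pos u i ↔ pos u k < pos u i := fun k => by
    rw [pos_cons]; split_ifs <;> omega
  have hgt : ∀ k, pos u i < pos (b :: u) k ↔ pos u i < pos u k := fun k => by
    rw [pos_cons]; split_ifs <;> omega
  have hv : ∀ v : List (Fin n), (∀ e ∈ v, (e : ℕ) ≠ pos u i ∧ (e : ℕ) + 1 ≠ pos u i) →
      ∀ e ∈ b :: v, (e : ℕ) ≠ pos u i ∧ (e : ℕ) + 1 ≠ pos u i := by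
    intro v hv e he
    rcases List.mem_cons.1 he with rfl | he
    · exact ⟨h1.symm, h2.symm⟩
    · exact hv e he
  unfold StringState
  simp only [hi, hlt, hgt]
  rcases h with h | ⟨v, d, r, hu, hd, he, h⟩ | ⟨v, d, r, hu, hd, he, h⟩
  · exact Or.inl h
  · exact Or.inr (Or.inl ⟨b :: v, d, r, by rw [hu]; rfl, hd, hv v he, h⟩)
  · exact Or.inr (Or.inr ⟨b :: v, d, r, by rw [hu]; rfl, hd, hv v he, h⟩)

/-- The upper of the two strings about to cross has not moved up last. -/
theorem Nested.upper_string {b : Fin n} {u : List (Fin n)} (h : Nested (b :: u)) {j : Fin (n + 1)}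
    (hs : StringState u j) (hj : pos u j = b + 1) :
    (b : ℕ) + 1 ≤ j ∧ ∀ k > j, (b : ℕ) + 1 < pos u k := by
  rcases hs with ⟨h1, -, h3⟩ | ⟨v, d, r, hu, hd, he, -⟩ | ⟨v, d, r, hu, hd, he, h1, h3⟩
  · rw [hj] at h1 h3
    exact ⟨h1.le, h3⟩
  · exfalso
    rw [hj] at hd he
    obtain rfl : d = b := Fin.ext (by omega)
    obtain ⟨⟨e, he1, he2⟩, -⟩ := h [] d v r (by rw [hu]; rfl) fun hm => (he d hm).2 rfl
    exact (he e he1).1 he2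
  · rw [hj] at h1 h3
    exact ⟨h1.le, h3⟩

/-- The lower of the two strings about to cross has either not moved down at all, or has moved
only once. -/
theorem Nested.lower_string {b : Fin n} {u : List (Fin n)} (h : Nested (b :: u)) {i : Fin (n + 1)}
    (hs : StringState u i) (hi : pos u i = b) :
    ((i : ℕ) ≤ b ∧ ∀ h < i, pos u h < b) ∨
    ((i : ℕ) = b + 1 ∧ (∃ h₀, ∀ h < i, (b : ℕ) ≤ pos u h → h = h₀) ∧
      (∀ k > i, (b : ℕ) < pos u k) ∧
      ∃ v₂ v₃ : List (Fin n), u = v₂ ++ b :: v₃ ∧ b ∉ v₂ ∧ ∀ e ∈ v₂, (e : ℕ) + 1 ≠ b) := by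
  rcases hs with ⟨h1, h2, -⟩ | ⟨v, d, r, hu, hd, he, h1 | h1⟩ | ⟨v, d, r, hu, hd, he, h1, h3⟩
  · rw [hi] at h1 h2
    exact Or.inl ⟨h1.ge, h2⟩
  · rw [hi] at h1
    exact Or.inl ⟨h1.1.le, h1.2⟩
  · -- the string has already returned, so column `b` admits no further entries
    exfalso
    obtain ⟨-, -, -, v₂, v₃, hr, hv₂, hv₂'⟩ := h1
    obtain ⟨-, h4⟩ := h (b :: v) d v₂ v₃ (by rw [hu, hr]; rfl) hv₂
    rcases h4 with ⟨e, he1, he2⟩ | h4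
    · exact hv₂' e he1 he2
    · have := h4 b (Or.inl List.mem_cons_self)
      omega
  · rw [hi] at hd he h1 h3
    obtain rfl : d = b := Fin.ext hd
    have hdv : d ∉ v := fun hm => (he d hm).1 rfl
    have hr := (h [] d v r (by rw [hu]; rfl) hdv).2
    replace hr : ∀ e ∈ r, (e : ℕ) ≠ d ∧ (e : ℕ) ≠ d + 1 := by
      rcases hr with ⟨e, he1, he2⟩ | hr
      · exact absurd he2 (he e he1).2
      · exact fun e he => hr e (Or.inr he)
    -- the string that starts just above column `d` is moved only by the last letter `d`
    have e1 : pos r d.succ = d + 1 := by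
      have := pos_append_of_forall (v := r) (u := []) (i := d.succ) (c := d + 1) (by simp)
        fun e he => ⟨(hr e he).2, by have := (hr e he).1; omega⟩
      simpa using this
    have e2 : pos u d.succ = d := by
      rw [hu]
      exact pos_append_of_forall (by rw [pos_cons, e1]; simp) he
    obtain rfl : i = d.succ := pos_inj.1 (hi.trans e2.symm)
    refine Or.inr ⟨rfl, ?_, h3, v, r, hu, hdv, fun e hm => (he e hm).2⟩
    obtain ⟨h₀, hh₀⟩ := exists_pos r (m := d) (by omega)
    refine ⟨h₀, fun x hx hle => ?_⟩
    by_contra hne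
    have f1 : pos r x ≤ d := by
      have := (pos_append_le_iff (v := r) (u := []) (fun e he => (hr e he).1) x).2
        (by rw [pos_nil]; rw [Fin.lt_def, Fin.val_succ] at hx; omega)
      simpa using this
    have f2 : pos r x ≠ d := by rw [← hh₀, Ne, pos_inj]; exact hne
    have f3 : pos (d :: r) x ≤ (d : ℕ) - 1 := by
      rw [pos_cons, if_neg f2, if_neg (by omega)]; omega
    have f4 := (pos_append_le_iff (v := v) (u := d :: r) (c := (d : ℕ) - 1)
      (fun e hm => by have := (he e hm).2; omega) x).2 f3
    rw [← hu] at f4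
    omega

theorem Nested.good_and_state {u : List (Fin n)} (h : Nested u) :
    Good u ∧ ∀ i, StringState u i := by
  induction u with
  | nil => exact ⟨trivial, fun i => Or.inl ⟨rfl, fun h hh => hh, fun k hk => hk⟩⟩
  | cons b u ih =>
    obtain ⟨hg, hs⟩ := ih h.of_cons
    obtain ⟨i, hi⟩ := exists_pos u (m := b) (by omega)
    obtain ⟨j, hj⟩ := exists_pos u (m := b + 1) (by omega)
    have hup := h.upper_string (hs j) hj
    have hlow := h.lower_string (hs i) hi
    have hne : (i : ℕ) ≠ j := fun e => by
      have := (pos_inj (u := u)).2 (Fin.ext e); omega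
    have hij : i < j := by
      rw [Fin.lt_def]
      rcases hlow with h | h <;> omega
    refine ⟨⟨hg, fun i' j' hi' hj' => ?_⟩, fun x => ?_⟩
    · obtain rfl : i' = i := pos_inj.1 (hi'.trans hi.symm)
      obtain rfl : j' = j := pos_inj.1 (hj'.trans hj.symm)
      exact ⟨hij, fun k hk => lt_trans (Nat.lt_succ_self _) (hup.2 k hk)⟩
    · by_cases hxi : x = i
      · subst hxi
        have hx : pos (b :: u) x = b + 1 := by rw [pos_cons, if_pos hi]
        refine Or.inr (Or.inl ⟨[], b, u, rfl, hx.symm, by simp, ?_⟩)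
        rw [hx]
        rcases hlow with ⟨h1, h2⟩ | ⟨h1, ⟨h₀, h2⟩, h3, h4⟩
        · refine Or.inl ⟨by omega, fun y hy => ?_⟩
          have := h2 y hy
          rw [pos_cons]; split_ifs <;> omega
        · refine Or.inr ⟨h1.symm, ⟨h₀, fun y hy hlt => ?_⟩, ⟨j, fun y hy hlt => ?_⟩, h4⟩
          · refine h2 y hy ?_
            rw [pos_cons] at hlt; split_ifs at hlt <;> omega
          · have := h3 y hy
            rw [← pos_inj (u := u), hj]
            rw [pos_cons] at hlt; split_ifs at hlt <;> omega
      · by_cases hxj : x = j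
        · subst hxj
          have hx : pos (b :: u) x = b := by
            rw [pos_cons, hj, if_neg (by omega), if_pos rfl]
          refine Or.inr (Or.inr ⟨[], b, u, rfl, hx.symm, by simp, ?_⟩)
          rw [hx]
          refine ⟨by omega, fun k hk => ?_⟩
          have := hup.2 k hk
          rw [pos_cons]; split_ifs <;> omega
        · exact (hs x).cons (by rwa [← hi, Ne, pos_inj]) (by rwa [← hj, Ne, pos_inj])

theorem Nested.good {u : List (Fin n)} (h : Nested u) : Good u := h.good_and_state.1

theorem Nested.star {u : List (Fin n)} (h : Nested u) : Star (wordProd u) := by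
  rw [star_wordProd_iff]
  intro x i y hx hy hxi hyi
  rcases h.good_and_state.2 i with ⟨-, h1, -⟩ | ⟨_, _, _, _, _, _, h1 | h1⟩ |
    ⟨_, _, _, _, _, _, _, h1⟩
  · exact absurd (h1 x hx) hxi.not_gt
  · exact absurd (h1.2 x hx) hxi.not_gt
  · obtain ⟨h1, ⟨h₀, h2⟩, ⟨k₀, h3⟩, -⟩ := h1
    exact ⟨h1, fun z hz hzi => (h2 z hz hzi).trans (h2 x hx hxi).symm,
      fun z hz hzi => (h3 z hz hzi).trans (h3 y hy hyi).symm⟩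
  · exact absurd (h1 y hy) hyi.not_gt

theorem Star.of_cons {b : Fin n} {u : List (Fin n)} (hr : RedWord (b :: u))
    (hs : Star (wordProd (b :: u))) : Star (wordProd u) := by
  rw [star_wordProd_iff] at hs ⊢
  intro h i k hh hk hhi hki
  have hr' : RedWord ([b] ++ u) := hr
  obtain ⟨h1, h2, h3⟩ := hs h i k hh hk (hr'.pos_lt hh hhi) (hr'.pos_lt hk hki)
  have h2' : ∀ h' < i, pos u i < pos u h' → h' = h := fun h' hl hlt => h2 h' hl (hr'.pos_lt hl hlt)
  have h3' : ∀ k' > i, pos u k' < pos u i → k' = k := fun k' hl hlt => h3 k' hl (hr'.pos_lt hl hlt)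
  refine ⟨?_, h2', h3'⟩
  -- a further crossing of the string `i` would contradict the uniqueness of `h` and `k`
  rw [pos_cons] at h1
  split_ifs at h1 with e1 e2
  · exfalso
    obtain ⟨j, hj⟩ := exists_pos u (m := b + 1) (by omega)
    have hij := hr.2 i j e1 hj
    have := h3 j hij (by
      rw [pos_cons, pos_cons, if_pos e1, hj, if_neg (by omega), if_pos rfl]; omega)
    rw [this] at hj; omega
  · exfalso
    obtain ⟨j, hj⟩ := exists_pos u (m := b) (by omega)
    have hij := hr.2 j i hj e2
    have := h2 j hij (by
      rw [pos_cons, pos_cons, if_pos hj, e2, if_neg (by omega), if_pos rfl]; omega)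
    rw [this] at hj; omega
  · exact h1

/-! ### Good words with isolated middles have nested columns -/

/-- A string without crossings has not been moved. -/
theorem RedWord.not_mem_of_forall {u : List (Fin n)} (hr : RedWord u) {i : Fin (n + 1)}
    (h1 : ∀ h < i, pos u h < pos u i) (h2 : ∀ k > i, pos u i < pos u k) :
    pos u i = i ∧ ∀ e ∈ u, (e : ℕ) ≠ i ∧ (e : ℕ) + 1 ≠ i := by
  induction u with
  | nil => simp
  | cons b u ih =>
    have hr' : RedWord ([b] ++ u) := hr
    obtain ⟨h3, h4⟩ := ih hr.1
      (fun h hh => lt_of_le_of_ne (not_lt.1 fun hlt => absurd (hr'.pos_lt hh hlt) (h1 h hh).not_gt)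
        fun e => hh.ne (pos_inj.1 e))
      (fun k hk => lt_of_le_of_ne (not_lt.1 fun hlt => absurd (hr'.pos_lt hk hlt) (h2 k hk).not_gt)
        fun e => hk.ne (pos_inj.1 e))
    have h5 : pos u i ≠ b := fun e => by
      obtain ⟨j, hj⟩ := exists_pos u (m := b + 1) (by omega)
      have := h2 j (hr.2 i j e hj)
      rw [pos_cons, pos_cons, if_pos e, hj, if_neg (by omega), if_pos rfl] at this
      omega
    have h6 : pos u i ≠ b + 1 := fun e => by
      obtain ⟨j, hj⟩ := exists_pos u (m := b) (by omega)
      have := h1 j (hr.2 j i hj e)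
      rw [pos_cons, pos_cons, if_pos hj, e, if_neg (by omega), if_pos rfl] at this
      omega
    refine ⟨by rw [pos_cons, if_neg h5, if_neg h6, h3], fun e he => ?_⟩
    rcases List.mem_cons.1 he with rfl | he
    · rw [h3] at h5 h6; exact ⟨h5.symm, h6.symm⟩
    · exact h4 e he

/-- The string that starts just above a column with no entry to the left between two consecutive
entries is a middle. -/
theorem RedWord.middle_of_pair {v₁ v₂ v₃ : List (Fin n)} {c : Fin n}
    (hr : RedWord (v₁ ++ c :: (v₂ ++ c :: v₃))) (h2 : ∀ e ∈ v₂, e ≠ c ∧ (e : ℕ) + 1 ≠ c)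
    (h13 : ∀ d, d ∈ v₁ ∨ d ∈ v₃ → (d : ℕ) ≠ c ∧ (d : ℕ) ≠ c + 1) :
    pos (v₁ ++ c :: (v₂ ++ c :: v₃)) c.succ = c + 1 ∧
      ∃ h k, h < c.succ ∧ c.succ < k ∧
        c + 1 < pos (v₁ ++ c :: (v₂ ++ c :: v₃)) h ∧
        pos (v₁ ++ c :: (v₂ ++ c :: v₃)) k < c + 1 := by
  have h2' : ∀ e ∈ v₂, (e : ℕ) ≠ c ∧ (e : ℕ) + 1 ≠ c := fun e he =>
    ⟨fun h => (h2 e he).1 (Fin.ext h), (h2 e he).2⟩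
  have e1 : pos v₃ c.succ = c + 1 := by
    have := pos_append_of_forall (v := v₃) (u := []) (i := c.succ) (c := c + 1) (by simp)
      fun e he => ⟨(h13 e (Or.inr he)).2, by have := (h13 e (Or.inr he)).1; omega⟩
    simpa using this
  have e2 : pos (c :: v₃) c.succ = c := by rw [pos_cons, e1]; simp
  have e3 : pos (v₂ ++ c :: v₃) c.succ = c := pos_append_of_forall e2 h2'
  have e4 : pos (c :: (v₂ ++ c :: v₃)) c.succ = c + 1 := by rw [pos_cons, if_pos e3]
  have e5 : pos (v₁ ++ c :: (v₂ ++ c :: v₃)) c.succ = c + 1 :=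
    pos_append_of_forall e4 fun e he =>
      ⟨(h13 e (Or.inl he)).2, by have := (h13 e (Or.inl he)).1; omega⟩
  obtain ⟨h, hh⟩ := exists_pos v₃ (m := c) (by omega)
  obtain ⟨k, hk⟩ := exists_pos (v₂ ++ c :: v₃) (m := c + 1) (by omega)
  have hr2 := hr.of_append
  have hr3 := hr2.1.of_append
  have hlt1 : h < c.succ := hr3.2 h c.succ hh e1
  have hlt2 : c.succ < k := hr2.2 c.succ k e3 hk
  refine ⟨e5, h, k, hlt1, hlt2, ?_, ?_⟩
  · have hr4 : RedWord ((v₁ ++ c :: v₂) ++ c :: v₃) := by simpa using hr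
    have := hr4.pos_lt hlt1 (by rw [e2, pos_cons, if_pos hh]; omega)
    simpa [e5] using this
  · have := hr.pos_lt hlt2 (by
      rw [e4, pos_cons, if_neg (by omega), if_pos hk]; omega)
    rwa [e5] at this

/-- The strings that meet in two consecutive entries of a column show which neighbouring columns
must have entries between them. -/
theorem Good.nested {u : List (Fin n)} (hg : Good u) (hs : Star (wordProd u)) : Nested u := by
  induction u with
  | nil => intro v₁ c v₂ v₃ hu; simp at hu
  | cons b u ih =>
    have hr := hg.redWord
    have hr' : RedWord ([b] ++ u) := hr
    have hnest := ih hg.1 (hs.of_cons hr)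
    rw [star_wordProd_iff] at hs
    intro v₁ c v₂ v₃ hu hc
    cases v₁ with
    | cons b' v₁ =>
      rw [List.cons_append, List.cons.injEq] at hu
      obtain ⟨rfl, hu⟩ := hu
      obtain ⟨h1, h2⟩ := hnest v₁ c v₂ v₃ hu hc
      refine ⟨h1, ?_⟩
      by_cases h3 : ∃ d ∈ v₂, (d : ℕ) + 1 = c
      · exact Or.inl h3
      · have h4 := h2.resolve_left h3
        refine Or.inr fun d hd => ?_
        rcases or_assoc.1 (hd.imp_left List.mem_cons.1) with rfl | hd
        · -- the middle string of column `c` is a fixed point, so it is not moved once more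
          have hr'' := hr.1
          push Not at h3
          rw [hu] at hr''
          obtain ⟨e1, h, k, hh, hk, hh', hk'⟩ := hr''.middle_of_pair
            (fun e he => ⟨fun hec => hc (hec ▸ he), h3 e he⟩) h4
          rw [← hu] at e1 hh' hk'
          have := (hs h c.succ k hh hk (hr'.pos_lt hh (by rwa [e1]))
            (hr'.pos_lt hk (by rwa [e1]))).1
          rw [pos_cons, e1, Fin.val_succ] at this
          split_ifs at this <;> omega
        · exact h4 d hd
    | nil =>
      rw [List.nil_append, List.cons.injEq] at hu
      obtain ⟨rfl, hu⟩ := hu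
      have hr3 : RedWord (v₂ ++ b :: v₃) := by rw [← hu]; exact hr.1
      have hr4 := hr3.of_append
      -- `α` and `β` meet at the right entry of the pair
      obtain ⟨α, hα⟩ := exists_pos v₃ (m := b) (by omega)
      obtain ⟨β, hβ⟩ := exists_pos v₃ (m := b + 1) (by omega)
      have hαβ := hr4.2 α β hα hβ
      have hα' : pos (b :: v₃) α = b + 1 := by rw [pos_cons, if_pos hα]
      have hβ' : pos (b :: v₃) β = b := by rw [pos_cons, hβ, if_neg (by omega), if_pos rfl]
      have hc' : ∀ d ∈ v₂, (d : ℕ) ≠ b := fun d hd h => hc (Fin.ext h ▸ hd)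
      have hβ2 : pos u β ≤ b := by rw [hu, pos_append_le_iff hc', hβ']
      have hα2 : ¬ pos u α ≤ b := by rw [hu, pos_append_le_iff hc', hα']; omega
      refine ⟨?_, ?_⟩
      · by_contra hno
        push Not at hno
        have e1 : pos u α = b + 1 := by
          rw [hu]
          exact pos_append_of_forall hα' fun d hd => ⟨hno d hd, by have := hc' d hd; omega⟩
        obtain ⟨γ, hγ⟩ := exists_pos u (m := b) (by omega)
        have := (hg.2 γ α hγ e1).2 β hαβ
        omega
      · by_cases h3 : ∃ d ∈ v₂, (d : ℕ) + 1 = b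
        · exact Or.inl h3
        · right
          push Not at h3
          have e1 : pos u β = b := by
            rw [hu]; exact pos_append_of_forall hβ' fun d hd => ⟨hc' d hd, h3 d hd⟩
          obtain ⟨γ, hγ⟩ := exists_pos u (m := b + 1) (by omega)
          have hβγ := hr.2 β γ e1 hγ
          have f1 : pos u β < pos u α := by omega
          have g1 : pos (b :: u) β < pos (b :: u) α := hr'.pos_lt hαβ f1
          have g2 : pos (b :: u) γ < pos (b :: u) β := by
            rw [pos_cons, pos_cons, if_pos e1, hγ, if_neg (by omega), if_pos rfl]; omega
          -- `β` is a middle, whose only crossings are those with `α` and `γ`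
          obtain ⟨s1, s2, s3⟩ := hs α β γ hαβ hβγ g1 g2
          have s1' : (β : ℕ) = b + 1 := by rw [← s1, pos_cons, if_pos e1]
          have hr6 : b :: (v₂ ++ [b]) ++ v₃ = b :: u := by rw [hu]; simp
          have hr5 : RedWord ((b :: (v₂ ++ [b])) ++ v₃) := by rw [hr6]; exact hr
          have hr7 : (v₂ ++ [b]) ++ v₃ = u := by rw [hu]; simp
          have hr8 : RedWord ((v₂ ++ [b]) ++ v₃) := by rw [hr7]; exact hr.1
          have key := hr4.1.not_mem_of_forall (i := β)
            (fun h hh => by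
              by_contra hcon
              have hne : pos v₃ h ≠ pos v₃ β := fun e => hh.ne (pos_inj.1 e)
              have := hr5.pos_lt hh (by omega : pos v₃ β < pos v₃ h)
              rw [hr6] at this
              rw [s2 h hh this] at hcon
              omega)
            (fun k hk => by
              by_contra hcon
              have hne : pos v₃ k ≠ pos v₃ β := fun e => hk.ne' (pos_inj.1 e)
              have hlt : pos v₃ k < pos v₃ β := by omega
              have := hr5.pos_lt hk hlt
              rw [hr6] at this
              obtain rfl := s3 k hk this
              have := hr8.pos_lt hk hlt
              rw [hr7] at this
              omega)
          intro d hd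
          have := key.2 d (by simpa using hd)
          omega

/-! ### Positions and splittings of a word -/

/-- The positions that correspond to two letters separating a word into three factors. -/
theorem exists_positions {u v₁ v₂ v₃ : List (Fin n)} {c c' : Fin n}
    (hu : u = v₁ ++ c :: (v₂ ++ c' :: v₃)) : ∃ x y : Fin u.length, x < y ∧ u.get x = c ∧
      u.get y = c' ∧ (∀ z, x < z → z < y → u.get z ∈ v₂) ∧
      (∀ z, z < x → u.get z ∈ v₁) ∧ (∀ z, y < z → u.get z ∈ v₃) ∧
      ∀ d, d ∈ v₁ ∨ d ∈ v₃ → ∃ z, (z < x ∨ y < z) ∧ u.get z = d := by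
  subst hu
  refine ⟨⟨v₁.length, by simp⟩, ⟨v₁.length + 1 + v₂.length, by simp; omega⟩, ?_, ?_, ?_, ?_, ?_, ?_, ?_⟩
  · rw [Fin.lt_def]; simp only; omega
  · simp
  · simp only [List.get_eq_getElem, List.getElem_append, List.getElem_cons]
    rw [dif_neg (by omega), dif_neg (by omega), dif_neg (by omega), dif_pos (by omega)]
  · rintro ⟨z, hz⟩ h1 h2
    rw [Fin.lt_def] at h1 h2
    simp only at h1 h2
    simp only [List.get_eq_getElem, List.getElem_append, List.getElem_cons]
    rw [dif_neg (by omega), dif_neg (by omega), dif_pos (by omega)]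
    exact List.getElem_mem _
  · rintro ⟨z, hz⟩ h1
    rw [Fin.lt_def] at h1
    simp only at h1
    simp only [List.get_eq_getElem, List.getElem_append]
    rw [dif_pos h1]
    exact List.getElem_mem _
  · rintro ⟨z, hz⟩ h1
    rw [Fin.lt_def] at h1
    simp only at h1
    simp only [List.get_eq_getElem, List.getElem_append, List.getElem_cons]
    rw [dif_neg (by omega), dif_neg (by omega), dif_neg (by omega), dif_neg (by omega)]
    exact List.getElem_mem _
  · rintro d (hd | hd)
    · obtain ⟨i, hi, rfl⟩ := List.mem_iff_getElem.1 hd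
      refine ⟨⟨i, by simp; omega⟩, Or.inl (by rw [Fin.lt_def]; simpa using hi), ?_⟩
      simp [hi]
    · obtain ⟨i, hi, rfl⟩ := List.mem_iff_getElem.1 hd
      refine ⟨⟨v₁.length + 1 + v₂.length + 1 + i, by simp; omega⟩,
        Or.inr (by rw [Fin.lt_def]; simp only; omega), ?_⟩
      simp only [List.get_eq_getElem, List.getElem_append, List.getElem_cons]
      rw [dif_neg (by omega), dif_neg (by omega), dif_neg (by omega), dif_neg (by omega)]
      congr 1
      omega

/-- Two positions split a word into three factors; the middle one holds the letters between. -/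
theorem exists_split {u : List (Fin n)} {x y : Fin u.length} (h : x < y) :
    ∃ v₁ v₂ v₃, u = v₁ ++ u.get x :: (v₂ ++ u.get y :: v₃) ∧
      ∀ d ∈ v₂, ∃ z, x < z ∧ z < y ∧ u.get z = d := by
  have h' : (x : ℕ) < y := h
  refine ⟨u.take x, (u.drop (x + 1)).take (y - (x + 1)), u.drop (y + 1), ?_, ?_⟩
  · have e1 : u.get y :: u.drop (y + 1) = u.drop y := (List.drop_eq_getElem_cons y.2).symm
    have e2 : u.drop y = (u.drop (x + 1)).drop (y - (x + 1)) := by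
      rw [List.drop_drop]; congr 1; omega
    rw [e1, e2, List.take_append_drop]
    have e3 : u.get x :: u.drop (x + 1) = u.drop x := (List.drop_eq_getElem_cons x.2).symm
    rw [e3, List.take_append_drop]
  · intro d hd
    obtain ⟨i, hi, rfl⟩ := List.mem_iff_getElem.1 hd
    have hi' := hi
    simp only [List.length_take, List.length_drop] at hi'
    refine ⟨⟨x + 1 + i, by omega⟩, ?_, ?_, ?_⟩
    · rw [Fin.lt_def]; simp only; omega
    · rw [Fin.lt_def]; simp only; omega
    · simp

theorem HeapLT.lt {u : List (Fin n)} {x y : Fin u.length} (h : HeapLT u x y) : x < y := by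
  induction h with
  | single h => exact h.1
  | tail _ h ih => exact ih.trans h.1

/-- Positions that spell out a chain of adjacent letters are increasing in the heap. -/
theorem heapLT_of_isChain {u K : List (Fin n)} {f : Fin K.length → Fin u.length}
    (hf : StrictMono f) (hget : ∀ i, u.get (f i) = K.get i) (hK : K.IsChain Adjacent)
    {i j : Fin K.length} (hij : i < j) : HeapLT u (f i) (f j) := by
  obtain ⟨j, hj⟩ := j
  induction j with
  | zero => exact absurd hij (Nat.not_lt_zero _)
  | succ j ih =>
    have hstep : HeapLT u (f ⟨j, by omega⟩) (f ⟨j + 1, hj⟩) := by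
      refine Relation.TransGen.single ⟨hf (by rw [Fin.lt_def]; simp), Or.inl ?_⟩
      rw [hget, hget]
      exact List.isChain_iff_getElem.1 hK j hj
    rcases lt_or_eq_of_le (Nat.lt_succ_iff.1 hij : (i : ℕ) ≤ j) with h | h
    · exact (ih (by omega) h).trans hstep
    · have : i = ⟨j, by omega⟩ := Fin.ext h
      rw [this]; exact hstep

/-! ### The canonical braid cluster -/

theorem canonicalCluster_self (p : Fin n) : canonicalCluster p p = [p] := by
  unfold canonicalCluster
  have h1 : (List.finRange n).filter (fun i => p ≤ i ∧ i ≤ p) = [p] := by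
    refine List.SortedLT.eq_of_mem_iff ?_ (by simp [List.sortedLT_iff_pairwise]) fun d => ?_
    · exact ((List.sortedLT_finRange n).pairwise.filter _).sortedLT
    · simp only [List.mem_filter, List.mem_finRange, decide_eq_true_eq, true_and,
        List.mem_singleton]
      omega
  have h2 : (List.finRange n).filter (fun i => p ≤ i ∧ i < p) = [] := by
    simp only [List.filter_eq_nil_iff, List.mem_finRange, decide_eq_true_eq, true_implies]
    exact fun a h => absurd h.2 h.1.not_gt
  rw [h1, h2]; rfl

theorem canonicalCluster_eq_append {p c q : Fin n} (hpc : p ≤ c) (hcq : c ≤ q) :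
    canonicalCluster p q = (List.finRange n).filter (fun i => p ≤ i ∧ i < c) ++
      (canonicalCluster c q ++ ((List.finRange n).filter (fun i => p ≤ i ∧ i < c)).reverse) := by
  have hs : ∀ P : Fin n → Bool, ((List.finRange n).filter P).SortedLT := fun P =>
    ((List.sortedLT_finRange n).pairwise.filter _).sortedLT
  have h1 : (List.finRange n).filter (fun i => p ≤ i ∧ i ≤ q) =
      (List.finRange n).filter (fun i => p ≤ i ∧ i < c) ++
        (List.finRange n).filter (fun i => c ≤ i ∧ i ≤ q) := by
    refine List.SortedLT.eq_of_mem_iff (hs _) ?_ fun d => ?_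
    · refine (List.pairwise_append.2 ⟨(hs _).pairwise, (hs _).pairwise, fun a ha b hb => ?_⟩).sortedLT
      simp only [List.mem_filter, List.mem_finRange, decide_eq_true_eq, true_and] at ha hb
      exact ha.2.trans_le hb.1
    · simp only [List.mem_append, List.mem_filter, List.mem_finRange, decide_eq_true_eq, true_and]
      omega
  have h2 : (List.finRange n).filter (fun i => p ≤ i ∧ i < q) =
      (List.finRange n).filter (fun i => p ≤ i ∧ i < c) ++
        (List.finRange n).filter (fun i => c ≤ i ∧ i < q) := by
    refine List.SortedLT.eq_of_mem_iff (hs _) ?_ fun d => ?_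
    · refine (List.pairwise_append.2 ⟨(hs _).pairwise, (hs _).pairwise, fun a ha b hb => ?_⟩).sortedLT
      simp only [List.mem_filter, List.mem_finRange, decide_eq_true_eq, true_and] at ha hb
      exact ha.2.trans_le hb.1
    · simp only [List.mem_append, List.mem_filter, List.mem_finRange, decide_eq_true_eq, true_and]
      omega
  unfold canonicalCluster
  rw [h1, h2, List.reverse_append]
  simp only [List.append_assoc]

theorem canonicalCluster_cons {p p' q : Fin n} (hp : (p : ℕ) + 1 = p') (hq : p' ≤ q) :
    canonicalCluster p q = p :: (canonicalCluster p' q ++ [p]) := by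
  have h1 : (List.finRange n).filter (fun i => p ≤ i ∧ i < p') = [p] := by
    refine List.SortedLT.eq_of_mem_iff ?_ (by simp [List.sortedLT_iff_pairwise]) fun d => ?_
    · exact ((List.sortedLT_finRange n).pairwise.filter _).sortedLT
    · simp only [List.mem_filter, List.mem_finRange, decide_eq_true_eq, true_and,
        List.mem_singleton]
      omega
  rw [canonicalCluster_eq_append (c := p') (by omega) hq, h1]
  rfl

theorem mem_canonicalCluster {p q d : Fin n} : d ∈ canonicalCluster p q ↔ p ≤ d ∧ d ≤ q := by
  simp only [canonicalCluster, List.mem_append, List.mem_reverse, List.mem_filter,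
    List.mem_finRange, decide_eq_true_eq, true_and]
  omega

theorem canonicalCluster_isChain {p q : Fin n} (hpq : p ≤ q) :
    (canonicalCluster p q).IsChain Adjacent ∧ (canonicalCluster p q).head? = some p ∧
      (canonicalCluster p q).getLast? = some p := by
  obtain ⟨d, hd⟩ : ∃ d, (q : ℕ) = p + d := ⟨q - p, by omega⟩
  induction d generalizing p with
  | zero =>
    obtain rfl : p = q := Fin.ext (by omega)
    rw [canonicalCluster_self]
    simp
  | succ d ih =>
    have hp : (p : ℕ) + 1 < n := by omega
    obtain ⟨h1, h2, h3⟩ := ih (p := ⟨p + 1, hp⟩) (by rw [Fin.le_def]; simp only; omega)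
      (by simp only; omega)
    rw [canonicalCluster_cons (p' := ⟨p + 1, hp⟩) rfl (by rw [Fin.le_def]; simp; omega)]
    generalize canonicalCluster ⟨p + 1, hp⟩ q = K at *
    refine ⟨?_, rfl, by rw [← List.cons_append, List.getLast?_concat]⟩
    rw [List.isChain_cons, List.isChain_append]
    refine ⟨fun y hy => ?_, h1, by simp, fun x hx y hy => ?_⟩
    · rw [List.head?_append, h2] at hy
      simp only [Option.some_or, Option.mem_def, Option.some.injEq] at hy
      exact Or.inl (by rw [← hy])
    · rw [h3] at hx
      simp only [Option.mem_def, Option.some.injEq, List.head?_cons] at hx hy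
      exact Or.inr (by rw [← hx, ← hy])

theorem heapLT_canonicalCluster {p q : Fin n} (hpq : p ≤ q)
    {i j : Fin (canonicalCluster p q).length} : HeapLT (canonicalCluster p q) i j ↔ i < j :=
  ⟨HeapLT.lt, fun h => heapLT_of_isChain (f := id) strictMono_id (fun _ => rfl)
    (canonicalCluster_isChain hpq).1 h⟩

/-! ### Heaps with a decomposition have nested columns -/

theorem HeapHasDecomposition.nested {u : List (Fin n)} (h : HeapHasDecomposition u) :
    Nested u := by
  obtain ⟨k, p, q, hpq, -, hres, hmin⟩ := h
  intro v₁ c v₂ v₃ hu hc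
  obtain ⟨x, y, hxy, hx, hy, hbt, -, -, hout⟩ := exists_positions hu
  by_cases hi : ∃ i, p i ≤ c ∧ c ≤ q i
  · obtain ⟨i, hpc, hcq⟩ := hi
    obtain ⟨e, he1, he2⟩ := hres i
    have hlt : ∀ a b, e a < e b ↔ HeapLT u a.1 b.1 := fun a b => by
      rw [← he2, heapLT_canonicalCluster (hpq i).le]
    have hxy' : e ⟨x, by rw [hx]; exact ⟨hpc, hcq⟩⟩ < e ⟨y, by rw [hy]; exact ⟨hpc, hcq⟩⟩ := by
      rw [hlt]
      exact Relation.TransGen.single ⟨hxy, Or.inr (hx.trans hy.symm)⟩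
    have hex := he1 ⟨x, by rw [hx]; exact ⟨hpc, hcq⟩⟩
    have hey := he1 ⟨y, by rw [hy]; exact ⟨hpc, hcq⟩⟩
    simp only [hx, hy] at hex hey
    have happ := canonicalCluster_eq_append hpc hcq
    have hL : ∀ d ∈ (List.finRange n).filter (fun j => p i ≤ j ∧ j < c), d < c := fun d hd => by
      simp only [List.mem_filter, List.mem_finRange, decide_eq_true_eq, true_and] at hd
      exact hd.2
    set L := (List.finRange n).filter (fun j => p i ≤ j ∧ j < c)
    rcases eq_or_lt_of_le hcq with hcq' | hcq'
    · -- the last column of the cluster has only one entry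
      exfalso
      subst hcq'
      rw [canonicalCluster_self] at happ
      have hcount : (canonicalCluster (p i) (q i)).count (q i) = 1 := by
        have h0 : L.count (q i) = 0 := List.count_eq_zero.2 fun hm => (hL _ hm).false
        rw [happ, List.count_append, List.count_append, List.count_reverse, h0]
        simp
      have hsub : [q i, q i].Sublist (canonicalCluster (p i) (q i)) := by
        obtain ⟨w₁, w₂, w₃, hw, -⟩ := exists_split hxy'
        rw [hex, hey] at hw
        rw [hw]
        exact ((List.nil_sublist w₁).append
          (((List.nil_sublist w₂).append ((List.nil_sublist w₃).cons_cons (q i))).cons_cons (q i)))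
      have := hsub.count_le (q i)
      rw [hcount] at this
      simp at this
    · have hcn : (c : ℕ) + 1 < n := by omega
      rw [canonicalCluster_cons (p' := ⟨c + 1, hcn⟩) rfl (by rw [Fin.le_def]; simp; omega)] at happ
      have happ' : canonicalCluster (p i) (q i) = L ++ c :: (canonicalCluster ⟨c + 1, hcn⟩ (q i) ++
          c :: L.reverse) := by
        rw [happ]; simp
      obtain ⟨x₀, y₀, hxy₀, hx₀, hy₀, hbt₀, hlo₀, hhi₀, -⟩ := exists_positions happ'
      have hL' : ∀ z, c ≤ (canonicalCluster (p i) (q i)).get z → x₀ ≤ z ∧ z ≤ y₀ := fun z hz => by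
        refine ⟨not_lt.1 fun hlt => ?_, not_lt.1 fun hlt => ?_⟩
        · exact absurd (hL _ (hlo₀ z hlt)) hz.not_gt
        · exact absurd (hL _ (List.mem_reverse.1 (hhi₀ z hlt))) hz.not_gt
      have hc₀ : ∀ z, (canonicalCluster (p i) (q i)).get z = c → z = x₀ ∨ z = y₀ := fun z hz => by
        by_contra hne
        push Not at hne
        obtain ⟨h1, h2⟩ := hL' z hz.ge
        have := (mem_canonicalCluster.1 (hbt₀ z (lt_of_le_of_ne h1 hne.1.symm)
          (lt_of_le_of_ne h2 hne.2))).1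
        rw [hz, Fin.le_def] at this
        simp at this
      have hc₁ : ∀ z, ((canonicalCluster (p i) (q i)).get z : ℕ) = c + 1 → x₀ < z ∧ z < y₀ :=
        fun z hz => by
          obtain ⟨h1, h2⟩ := hL' z (by rw [Fin.le_def]; omega)
          refine ⟨lt_of_le_of_ne h1 ?_, lt_of_le_of_ne h2 ?_⟩
          · rintro rfl; rw [hx₀] at hz; omega
          · rintro rfl; rw [hy₀] at hz; omega
      have hex' : e ⟨x, by rw [hx]; exact ⟨hpc, hcq⟩⟩ = x₀ := by
        rcases hc₀ _ hex with h | h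
        · exact h
        · rcases hc₀ _ hey with h' | h'
          · rw [h, h'] at hxy'; exact absurd hxy' hxy₀.not_gt
          · rw [h, h'] at hxy'; exact absurd hxy' (lt_irrefl _)
      have hey' : e ⟨y, by rw [hy]; exact ⟨hpc, hcq⟩⟩ = y₀ := by
        rcases hc₀ _ hey with h | h
        · rw [hex', h] at hxy'; exact absurd hxy' (lt_irrefl _)
        · exact h
      -- entries of column `c + 1` of the word lie between `x` and `y`
      have hup : ∀ z, (u.get z : ℕ) = c + 1 → x < z ∧ z < y := fun z hz => by
        have hz' : p i ≤ u.get z ∧ u.get z ≤ q i := by omega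
        have hez := hc₁ (e ⟨z, hz'⟩) (by rw [he1]; exact hz)
        rw [← hex', ← hey', hlt, hlt] at hez
        exact ⟨hez.1.lt, hez.2.lt⟩
      have hsame : ∀ z, u.get z = c → z = x ∨ z = y := fun z hz => by
        have hz' : p i ≤ u.get z ∧ u.get z ≤ q i := by rw [hz]; exact ⟨hpc, hcq⟩
        rcases hc₀ (e ⟨z, hz'⟩) (by rw [he1]; exact hz) with h | h
        · rw [← hex'] at h
          exact Or.inl (congrArg Subtype.val (e.injective h))
        · rw [← hey'] at h
          exact Or.inr (congrArg Subtype.val (e.injective h))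
      refine ⟨?_, Or.inr ?_⟩
      · have hm : (⟨c + 1, hcn⟩ : Fin n) ∈ canonicalCluster (p i) (q i) :=
          mem_canonicalCluster.2 (by simp only [Fin.le_def] at *; omega)
        obtain ⟨t, ht⟩ := List.get_of_mem hm
        have := he1 (e.symm t)
        rw [Equiv.apply_symm_apply, ht] at this
        have h1 := hup _ (by rw [← this])
        exact ⟨_, hbt _ h1.1 h1.2, by rw [← this]⟩
      · -- a further entry of column `c` or `c + 1` outside the pair would occupy another position
        intro d hd
        obtain ⟨z, hz, rfl⟩ := hout d hd
        refine ⟨fun h => ?_, fun h => ?_⟩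
        · rcases hsame z (Fin.ext h) with rfl | rfl <;> rcases hz with hz | hz
          · exact absurd hz (lt_irrefl _)
          · exact absurd hz hxy.not_gt
          · exact absurd hz hxy.not_gt
          · exact absurd hz (lt_irrefl _)
        · have := hup z h
          rcases hz with hz | hz
          · exact absurd hz this.1.not_gt
          · exact absurd hz this.2.not_gt
  · push Not at hi
    have hmp : IsMinimalPair u x y := by
      refine ⟨hx.trans hy.symm, Relation.TransGen.single ⟨hxy, Or.inr (hx.trans hy.symm)⟩, ?_⟩
      rintro ⟨z, hz, hxz, hzy⟩
      exact hc (by rw [← hx, ← hz]; exact hbt z hxz.lt hzy.lt)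
    obtain ⟨z, z', hne, ha, ha', h1, h2, h3, h4⟩ := hmin x y hmp (by
      rw [hx]; rintro i ⟨hpi, hqi⟩; exact absurd hqi (hi i hpi).not_ge)
    have hm := hbt z h1.lt h2.lt
    have hm' := hbt z' h3.lt h4.lt
    rw [hx] at ha ha'
    have hne' : (u.get z : ℕ) ≠ u.get z' := fun h => hne (Fin.ext h)
    unfold Adjacent at ha ha'
    rcases ha with ha | ha
    · exact ⟨⟨_, hm', by omega⟩, Or.inl ⟨_, hm, ha⟩⟩
    · exact ⟨⟨_, hm, by omega⟩, Or.inl ⟨_, hm', by omega⟩⟩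

/-! ### Decomposing heaps with nested columns -/

theorem restrictsToCanonicalCluster_of_filter {u : List (Fin n)} {p q : Fin n} (hpq : p ≤ q)
    (h : u.filter (fun d => p ≤ d ∧ d ≤ q) = canonicalCluster p q) :
    RestrictsToCanonicalCluster u p q := by
  -- the positions of the letters in question, in increasing order
  set M := (List.finRange u.length).filter (fun i => p ≤ u.get i ∧ u.get i ≤ q) with hM
  have hMs : M.SortedLT := ((List.sortedLT_finRange _).pairwise.filter _).sortedLT
  have hMm : ∀ i, i ∈ M ↔ p ≤ u.get i ∧ u.get i ≤ q := fun i => by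
    simp only [hM, List.mem_filter, List.mem_finRange, decide_eq_true_eq, true_and]
  have hmap : canonicalCluster p q = M.map u.get := by
    rw [← h]
    conv_lhs => rw [← List.map_get_finRange u]
    rw [List.filter_map]
    rfl
  have hlen : (canonicalCluster p q).length = M.length := by rw [hmap, List.length_map]
  let f : Fin (canonicalCluster p q).length → Fin u.length := fun i => M.get (Fin.cast hlen i)
  have hf : StrictMono f := fun i j hij => hMs.strictMono_get (by simpa using hij)
  have hfm : ∀ i, p ≤ u.get (f i) ∧ u.get (f i) ≤ q := fun i => (hMm _).1 (List.get_mem _ _)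
  have hget : ∀ i, u.get (f i) = (canonicalCluster p q).get i := fun i => by
    simp only [List.get_eq_getElem, hmap, List.getElem_map]
    rfl
  have hbij : Function.Bijective
      (fun i => (⟨f i, hfm i⟩ : {x : Fin u.length // p ≤ u.get x ∧ u.get x ≤ q})) := by
    refine ⟨fun i j hij => hf.injective (congrArg Subtype.val hij), fun x => ?_⟩
    obtain ⟨i, hi⟩ := List.get_of_mem ((hMm _).2 x.2)
    exact ⟨Fin.cast hlen.symm i, Subtype.ext hi⟩
  let E := Equiv.ofBijective _ hbij
  have hE : ∀ i, (E i).1 = f i := fun i => rfl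
  refine ⟨E.symm, fun x => ?_, fun x y => ?_⟩
  · obtain ⟨i, rfl⟩ := E.surjective x
    rw [Equiv.symm_apply_apply, hE, hget]
  · obtain ⟨i, rfl⟩ := E.surjective x
    obtain ⟨j, rfl⟩ := E.surjective y
    rw [Equiv.symm_apply_apply, Equiv.symm_apply_apply, hE, hE, heapLT_canonicalCluster hpq]
    exact ⟨fun hij => heapLT_of_isChain hf hget (canonicalCluster_isChain hpq).1 hij,
      fun hij => hf.lt_iff_lt.1 hij.lt⟩

/-- Column `c` has two consecutive entries without an entry of column `c - 1` between them. -/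
def Unresolved (u : List (Fin n)) (c : Fin n) : Prop :=
  ∃ v₁ v₂ v₃, u = v₁ ++ c :: (v₂ ++ c :: v₃) ∧ c ∉ v₂ ∧ ∀ e ∈ v₂, (e : ℕ) + 1 ≠ c

theorem Nested.of_unresolved {u : List (Fin n)} (h : Nested u) {c : Fin n} (hc : Unresolved u c) :
    ∃ v₁ v₂ v₃, u = v₁ ++ c :: (v₂ ++ c :: v₃) ∧ c ∉ v₂ ∧ (∀ e ∈ v₂, (e : ℕ) + 1 ≠ c) ∧
      (∃ d ∈ v₂, (d : ℕ) = c + 1) ∧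
      ∀ d, d ∈ v₁ ∨ d ∈ v₃ → (d : ℕ) ≠ c ∧ (d : ℕ) ≠ c + 1 := by
  obtain ⟨v₁, v₂, v₃, hu, hc, hv⟩ := hc
  obtain ⟨h1, h2⟩ := h v₁ c v₂ v₃ hu hc
  refine ⟨v₁, v₂, v₃, hu, hc, hv, h1, h2.resolve_left ?_⟩
  rintro ⟨d, hd, hdc⟩
  exact hv d hd hdc

/-- Right of a maximal run of unresolved columns there is a column with a single entry. -/
theorem Nested.filter_last {u : List (Fin n)} (h : Nested u) {c q : Fin n}
    (hcq : (c : ℕ) + 1 = q) (hc : Unresolved u c) (hq : ¬ Unresolved u q) :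
    u.filter (fun d => q ≤ d ∧ d ≤ q) = [q] := by
  obtain ⟨v₁, v₂, v₃, hu, hcv, hv, ⟨d, hd, hdc⟩, hv13⟩ := h.of_unresolved hc
  obtain rfl : d = q := Fin.ext (by omega)
  have hP : (fun e : Fin n => decide (d ≤ e ∧ e ≤ d)) = fun e => decide (e = d) := by
    funext e; rw [decide_eq_decide]; omega
  rw [hP]
  have hnil : ∀ l : List (Fin n), d ∉ l → l.filter (fun e => decide (e = d)) = [] := by
    intro l hl
    simp only [List.filter_eq_nil_iff, decide_eq_true_eq]
    rintro a ha rfl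
    exact hl ha
  obtain ⟨a, b, hv2, hda⟩ := List.eq_append_cons_of_mem hd
  have hdb : d ∉ b := by
    intro hdb
    obtain ⟨b', b'', hb, hdb'⟩ := List.eq_append_cons_of_mem hdb
    refine hq ⟨v₁ ++ c :: a, b', b'' ++ c :: v₃, by rw [hu, hv2, hb]; simp, hdb', fun e he hed => ?_⟩
    obtain rfl : e = c := Fin.ext (by omega)
    exact hcv (by rw [hv2, hb]; simp [he])
  have hne : c ≠ d := fun e => by rw [e] at hcq; omega
  have h1 : d ∉ v₁ := fun hm => (hv13 d (Or.inl hm)).2 hdc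
  have h3 : d ∉ v₃ := fun hm => (hv13 d (Or.inr hm)).2 hdc
  rw [hu, hv2]
  simp [hnil _ h1, hnil _ h3, hnil _ hda, hnil _ hdb, hne]

theorem Nested.filter_eq_canonicalCluster {u : List (Fin n)} (h : Nested u) {p q : Fin n}
    (hpq : p ≤ q) (hun : ∀ c, p ≤ c → c < q → Unresolved u c)
    (hq : u.filter (fun d => q ≤ d ∧ d ≤ q) = [q]) :
    u.filter (fun d => p ≤ d ∧ d ≤ q) = canonicalCluster p q := by
  obtain ⟨m, hm⟩ : ∃ m, (q : ℕ) = p + m := ⟨q - p, by omega⟩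
  induction m generalizing p with
  | zero =>
    obtain rfl : p = q := Fin.ext (by omega)
    rw [hq, canonicalCluster_self]
  | succ m ih =>
    obtain ⟨p', hp'⟩ : ∃ p' : Fin n, (p : ℕ) + 1 = p' := ⟨⟨p + 1, by omega⟩, rfl⟩
    have hp'q : p' ≤ q := by rw [Fin.le_def]; omega
    have hih := ih hp'q (fun c hc hcq => hun c (by omega) hcq) (by omega)
    obtain ⟨v₁, v₂, v₃, hu, hcv, -, -, hv13⟩ := h.of_unresolved (hun p le_rfl (by omega))
    rw [canonicalCluster_cons hp' hp'q, ← hih]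
    -- the cluster on the columns from `p + 1` begins and ends with `p + 1`, so all of it lies
    -- between the two letters `p`
    have hch := canonicalCluster_isChain hp'q
    rw [← hih, hu] at hch
    have hp1 : p' ∉ v₁ := fun hm => (hv13 p' (Or.inl hm)).2 hp'.symm
    have hp3 : p' ∉ v₃ := fun hm => (hv13 p' (Or.inr hm)).2 hp'.symm
    have hnp : decide (p' ≤ p ∧ p ≤ q) = false := by
      rw [decide_eq_false_iff_not]; omega
    simp only [List.filter_append, List.filter_cons, hnp, Bool.false_eq_true, if_false] at hch
    have h1 : v₁.filter (fun d => p' ≤ d ∧ d ≤ q) = [] := by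
      rcases hl : v₁.filter (fun d => p' ≤ d ∧ d ≤ q) with _ | ⟨x, l⟩
      · rfl
      · exfalso
        rw [hl] at hch
        have : x = p' := by simpa using hch.2.1
        have hx : x ∈ v₁.filter (fun d => p' ≤ d ∧ d ≤ q) := by rw [hl]; simp
        exact hp1 (this ▸ (List.mem_filter.1 hx).1)
    have h3 : v₃.filter (fun d => p' ≤ d ∧ d ≤ q) = [] := by
      rcases List.eq_nil_or_concat (v₃.filter (fun d => p' ≤ d ∧ d ≤ q)) with hl | ⟨l, x, hl⟩
      · exact hl
      · exfalso
        rw [hl, List.concat_eq_append, ← List.append_assoc, ← List.append_assoc,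
          List.getLast?_concat] at hch
        have : x = p' := by simpa using hch.2.2
        have hx : x ∈ v₃.filter (fun d => p' ≤ d ∧ d ≤ q) := by rw [hl]; simp
        exact hp3 (this ▸ (List.mem_filter.1 hx).1)
    have hcongr : ∀ l : List (Fin n), p ∉ l →
        l.filter (fun d => p ≤ d ∧ d ≤ q) = l.filter (fun d => p' ≤ d ∧ d ≤ q) := by
      intro l hl
      refine List.filter_congr fun d hd => ?_
      have : d ≠ p := fun e => hl (e ▸ hd)
      rw [decide_eq_decide]
      omega
    have hpp : decide (p ≤ p ∧ p ≤ q) = true := by simpa using hpq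
    rw [hu]
    simp only [List.filter_append, List.filter_cons, hnp, hpp, Bool.false_eq_true, if_false,
      if_true]
    rw [hcongr v₁ fun hm => (hv13 p (Or.inl hm)).1 rfl,
      hcongr v₃ fun hm => (hv13 p (Or.inr hm)).1 rfl, hcongr v₂ hcv, h1, h3]
    simp

/-- The maximal runs of unresolved columns, each with the next column added, carry the clusters. -/
theorem Nested.heapHasDecomposition {u : List (Fin n)} (h : Nested u) :
    HeapHasDecomposition u := by
  classical
  -- `S` consists of the first columns of the maximal runs
  let S : Finset (Fin n) := Finset.univ.filter fun p =>
    Unresolved u p ∧ ∀ d : Fin n, (d : ℕ) + 1 = p → ¬ Unresolved u d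
  have hend : ∀ p, Unresolved u p → ∃ q, p < q ∧ ¬ Unresolved u q ∧
      ∀ c, p ≤ c → c < q → Unresolved u c := by
    intro p hp
    have hex : ∃ q, p < q ∧ ¬ Unresolved u q := by
      by_contra hno
      push Not at hno
      have hall : ∀ m, ∃ c : Fin n, (c : ℕ) = p + m ∧ Unresolved u c := by
        intro m
        induction m with
        | zero => exact ⟨p, rfl, hp⟩
        | succ m ih =>
          obtain ⟨c, hc, hcu⟩ := ih
          obtain ⟨-, -, -, -, -, -, ⟨d, -, hd⟩, -⟩ := h.of_unresolved hcu
          exact ⟨d, by omega, hno d (by rw [Fin.lt_def]; omega)⟩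
      obtain ⟨c, hc, -⟩ := hall n
      omega
    obtain ⟨q, hq, hqm⟩ := (Finset.univ.filter fun q => p < q ∧ ¬ Unresolved u q).exists_minimal
      (by obtain ⟨q, hq⟩ := hex; exact ⟨q, by simpa using hq⟩)
    simp only [Finset.mem_filter, Finset.mem_univ, true_and] at hq hqm
    refine ⟨q, hq.1, hq.2, fun c hpc hcq => ?_⟩
    by_contra hcu
    rcases eq_or_lt_of_le hpc with rfl | hpc
    · exact hcu hp
    · exact absurd (hqm ⟨hpc, hcu⟩ hcq.le) hcq.not_ge
  have hSu : ∀ i, S.orderEmbOfFin rfl i ∈ S := fun i => Finset.orderEmbOfFin_mem S rfl i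
  have hS : ∀ i, Unresolved u (S.orderEmbOfFin rfl i) ∧
      ∀ d : Fin n, (d : ℕ) + 1 = S.orderEmbOfFin rfl i → ¬ Unresolved u d := fun i => by
    have := hSu i
    simpa only [S, Finset.mem_filter, Finset.mem_univ, true_and] using this
  choose q hq1 hq2 hq3 using fun i => hend _ (hS i).1
  refine ⟨S.card, S.orderEmbOfFin rfl, q, hq1, fun i j hij => ?_, fun i => ?_, fun x y hmp hout => ?_⟩
  · by_contra hcon
    have hlt : S.orderEmbOfFin rfl i < S.orderEmbOfFin rfl j :=
      (S.orderEmbOfFin rfl).strictMono hij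
    have hne : S.orderEmbOfFin rfl j ≠ q i := fun e => hq2 i (e ▸ (hS j).1)
    refine (hS j).2 ⟨(S.orderEmbOfFin rfl j : ℕ) - 1, by omega⟩ (by simp only; omega) ?_
    exact hq3 i _ (by rw [Fin.le_def]; simp only; omega) (by rw [Fin.lt_def]; simp only; omega)
  · have hlt := hq1 i
    refine restrictsToCanonicalCluster_of_filter hlt.le
      (h.filter_eq_canonicalCluster hlt.le (hq3 i) ?_)
    exact h.filter_last (c := ⟨(q i : ℕ) - 1, by omega⟩) (by simp only; omega)
      (hq3 i _ (by rw [Fin.le_def]; simp only; omega) (by rw [Fin.lt_def]; simp only; omega)) (hq2 i)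
  · obtain ⟨hxy, hlt, hno⟩ := hmp
    obtain ⟨v₁, v₂, v₃, hu, hbt⟩ := exists_split hlt.lt
    rw [← hxy] at hu
    have hxv : u.get x ∉ v₂ := fun hm => by
      obtain ⟨z, hxz, hzy, hz⟩ := hbt _ hm
      exact hno ⟨z, hz, Relation.TransGen.single ⟨hxz, Or.inr hz.symm⟩,
        Relation.TransGen.single ⟨hzy, Or.inr (hz.trans hxy)⟩⟩
    have hnun : ¬ Unresolved u (u.get x) := by
      intro hun
      -- descend to the start of the run
      have hstart : ∀ m (c : Fin n), (c : ℕ) = m → Unresolved u c →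
          ∃ p ∈ S, p ≤ c ∧ ∀ d, p ≤ d → d ≤ c → Unresolved u d := by
        intro m
        induction m with
        | zero =>
          intro c hc hcu
          refine ⟨c, ?_, le_rfl, fun d h1 h2 => le_antisymm h1 h2 ▸ hcu⟩
          simp only [S, Finset.mem_filter, Finset.mem_univ, true_and]
          exact ⟨hcu, fun d hd => by omega⟩
        | succ m ih =>
          intro c hc hcu
          by_cases hd : Unresolved u ⟨m, by omega⟩
          · obtain ⟨p, hp, hpm, hpu⟩ := ih _ rfl hd
            refine ⟨p, hp, hpm.trans (by rw [Fin.le_def]; simp only; omega), fun d h1 h2 => ?_⟩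
            rcases eq_or_lt_of_le h2 with rfl | h2
            · exact hcu
            · exact hpu d h1 (by rw [Fin.le_def]; simp only; omega)
          · refine ⟨c, ?_, le_rfl, fun d h1 h2 => le_antisymm h1 h2 ▸ hcu⟩
            simp only [S, Finset.mem_filter, Finset.mem_univ, true_and]
            refine ⟨hcu, fun d hdc => ?_⟩
            have : d = ⟨m, by omega⟩ := Fin.ext (by simp only; omega)
            rwa [this]
      obtain ⟨p, hp, hpx, hpu⟩ := hstart _ _ rfl hun
      obtain ⟨i, rfl⟩ : ∃ i, S.orderEmbOfFin rfl i = p := by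
        have := Finset.range_orderEmbOfFin S rfl
        exact (Set.ext_iff.1 this p).2 hp
      refine hout i ⟨hpx, ?_⟩
      by_contra hcon
      exact hq2 i (hpu _ (hq1 i).le (not_le.1 hcon).le)
    obtain ⟨⟨d, hd, hdx⟩, -⟩ := h v₁ _ v₂ v₃ hu hxv
    obtain ⟨d', hd', hdx'⟩ : ∃ d ∈ v₂, (d : ℕ) + 1 = u.get x := by
      by_contra hcon
      push Not at hcon
      exact hnun ⟨v₁, v₂, v₃, hu, hxv, hcon⟩
    obtain ⟨z, hz1, hz2, rfl⟩ := hbt d hd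
    obtain ⟨z', hz1', hz2', rfl⟩ := hbt d' hd'
    refine ⟨z, z', fun e => by rw [e] at hdx; omega, Or.inr hdx.symm, Or.inl hdx', ?_, ?_, ?_, ?_⟩
    · exact Relation.TransGen.single ⟨hz1, Or.inl (Or.inl hdx.symm)⟩
    · exact Relation.TransGen.single ⟨hz2, Or.inl (Or.inr (by rw [← hxy, hdx]))⟩
    · exact Relation.TransGen.single ⟨hz1', Or.inl (Or.inr hdx')⟩
    · exact Relation.TransGen.single ⟨hz2', Or.inl (Or.inl (by rw [← hxy, hdx']))⟩

/-! ### Braid clusters as reduced words for transpositions -/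

theorem wordProd_reverse (u : List (Fin n)) : wordProd u.reverse = (wordProd u)⁻¹ := by
  induction u with
  | nil => simp [wordProd_nil]
  | cons b u ih =>
    have hb : (gen b)⁻¹ = gen b := Equiv.swap_inv _ _
    rw [List.reverse_cons, wordProd_append, ih, wordProd_cons b u, mul_inv_rev, hb,
      wordProd_cons, wordProd_nil, mul_one]

theorem IsBraidCluster.exists_swap {m : ℕ} {c : List (Fin n)} (h : IsBraidCluster m c) :
    c.length = 2 * m + 1 ∧ ∃ A B, A < B ∧ wordProd c = Equiv.swap A B := by
  obtain ⟨-, i, -, rfl⟩ := h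
  refine ⟨by simp; omega, ?_⟩
  rw [List.ofFn_succ_last, wordProd_append, wordProd_append, wordProd_reverse, wordProd_cons,
    wordProd_nil, mul_one, gen, ← Equiv.swap_apply_apply]
  set g := wordProd (List.ofFn fun j : Fin m => i j.castSucc)
  rcases lt_or_gt_of_ne (g.injective.ne (Fin.castSucc_lt_succ (i := i (Fin.last m))).ne) with h | h
  · exact ⟨_, _, h, rfl⟩
  · exact ⟨_, _, h, Equiv.swap_comm _ _⟩

theorem exists_eq_add {p q : Fin n} (h : p < q) : ∃ p' : Fin n, (p : ℕ) + 1 = p' ∧ p' ≤ q :=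
  ⟨⟨p + 1, by omega⟩, rfl, by rw [Fin.le_def]; simp only; omega⟩

/-- Induction on the number of columns of a canonical braid cluster. -/
theorem cluster_induction {q : Fin n} {P : ∀ p : Fin n, p ≤ q → Prop} (base : P q le_rfl)
    (step : ∀ (p p' : Fin n) (_ : (p : ℕ) + 1 = p') (hq : p' ≤ q), P p' hq → P p (by omega))
    (p : Fin n) (hpq : p ≤ q) : P p hpq := by
  obtain ⟨m, hm⟩ : ∃ m, (q : ℕ) = p + m := ⟨q - p, by omega⟩
  induction m generalizing p with
  | zero =>
    obtain rfl : p = q := Fin.ext (by omega)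
    exact base
  | succ m ih =>
    obtain ⟨p', hp', hq⟩ := exists_eq_add (p := p) (q := q) (by omega)
    exact step p p' hp' hq (ih p' hq (by omega))

theorem wordProd_canonicalCluster {p q : Fin n} (hpq : p ≤ q) :
    wordProd (canonicalCluster p q) = Equiv.swap p.castSucc q.succ := by
  induction p, hpq using cluster_induction with
  | base => rw [canonicalCluster_self, wordProd_cons, wordProd_nil, mul_one, gen]
  | step p p' hp' hq ih =>
    have hb : gen p = (gen p)⁻¹ := (Equiv.swap_inv _ _).symm
    rw [canonicalCluster_cons hp' hq, wordProd_cons, wordProd_append, ih, wordProd_cons,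
      wordProd_nil, mul_one, ← mul_assoc]
    conv_lhs => enter [2]; rw [hb]
    rw [← Equiv.swap_apply_apply]
    congr 1
    · ext
      rw [gen_val]
      simp only [Fin.val_castSucc]
      split_ifs <;> omega
    · ext
      rw [gen_val]
      simp only [Fin.val_succ]
      rw [Fin.le_def] at hq
      split_ifs <;> omega

theorem length_canonicalCluster {p q : Fin n} (hpq : p ≤ q) :
    (canonicalCluster p q).length = 2 * ((q : ℕ) - p) + 1 := by
  induction p, hpq using cluster_induction with
  | base => simp [canonicalCluster_self]
  | step p p' hp' hq ih =>
    rw [canonicalCluster_cons hp' hq, List.length_cons, List.length_append, ih]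
    simp only [List.length_cons, List.length_nil]
    rw [Fin.le_def] at hq
    omega

theorem isBraidCluster_canonicalCluster {p q : Fin n} (hpq : p < q) :
    IsBraidCluster ((q : ℕ) - p) (canonicalCluster p q) := by
  have key : ∀ (m : ℕ) (p : Fin n) (i : Fin (m + 1) → Fin n), (q : ℕ) = p + m →
      (∀ l, (i l : ℕ) = p + l) → canonicalCluster p q =
        List.ofFn i ++ (List.ofFn fun j : Fin m => i j.castSucc).reverse := by
    intro m
    induction m with
    | zero =>
      intro p i hq hi
      obtain rfl : p = q := Fin.ext (by omega)
      have : i 0 = p := Fin.ext (by simpa using hi 0)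
      simp [canonicalCluster_self, this]
    | succ m ih =>
      intro p i hq hi
      obtain ⟨p', hp', hq'⟩ := exists_eq_add (p := p) (q := q) (by omega)
      have h0 : i 0 = p := Fin.ext (by simpa using hi 0)
      rw [canonicalCluster_cons hp' hq', ih p' (fun l => i l.succ) (by omega)
        (fun l => by rw [hi, Fin.val_succ]; omega), List.ofFn_succ (f := i),
        List.ofFn_succ (f := fun j : Fin (m + 1) => i j.castSucc), h0]
      have h0' : i (Fin.castSucc 0) = p := h0
      simp only [h0', List.reverse_cons, List.cons_append, List.append_assoc]
      rfl
  refine ⟨by omega, fun l => ⟨p + l, by omega⟩, fun l hl => ?_, key _ p _ (by omega) fun l => rfl⟩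
  rw [Fin.lt_def, Fin.val_last] at hl
  refine ⟨⟨l + 1, by omega⟩, ⟨by rw [Fin.lt_def]; simp, Or.inl (by simp only; omega)⟩, ?_⟩
  rintro y ⟨hy1, hy2⟩
  rw [Fin.lt_def] at hy1
  unfold Adjacent at hy2
  simp only at hy2
  ext
  simp only
  omega

/-- Prepending a reduced word to one that keeps the order of all strings entering the columns of
the former yields a reduced word. -/
theorem RedWord.append {v u : List (Fin n)} {p q : Fin n} (hv : RedWord v) (hu : RedWord u)
    (hpq : ∀ d ∈ v, p ≤ d ∧ d ≤ q)
    (hmono : ∀ i j, (p : ℕ) ≤ pos u i → pos u i < pos u j → pos u j ≤ q + 1 → i < j) :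
    RedWord (v ++ u) := by
  induction v with
  | nil => exact hu
  | cons b v ih =>
    refine ⟨ih hv.1 fun d hd => hpq d (List.mem_cons_of_mem _ hd), fun i j hi hj => ?_⟩
    have hi' : pos v (wordProd u i) = b := by rw [← pos_append]; exact hi
    have hj' : pos v (wordProd u j) = b + 1 := by rw [← pos_append]; exact hj
    have hlt : pos u i < pos u j := hv.2 _ _ hi' hj'
    obtain ⟨hpb, hbq⟩ := hpq b List.mem_cons_self
    rw [Fin.le_def] at hpb hbq
    have hlow : (p : ℕ) ≤ pos u i := by
      by_contra hcon
      have h1 := pos_append_le_iff (v := v) (u := u) (c := (p : ℕ) - 1) (fun d hd => by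
        have := (hpq d (List.mem_cons_of_mem _ hd)).1
        rw [Fin.le_def] at this; omega) i
      have : pos (v ++ u) i = b := hi
      omega
    have hhigh : pos u j ≤ q + 1 := by
      rw [← pos_append_le_iff (v := v) (u := u) (c := (q : ℕ) + 1) (fun d hd => by
        have := (hpq d (List.mem_cons_of_mem _ hd)).2
        rw [Fin.le_def] at this; omega) j]
      have : pos (v ++ u) j = b + 1 := hj
      omega
    exact hmono i j hlow hlt hhigh

theorem redWord_canonicalCluster {p q : Fin n} (hpq : p ≤ q) : RedWord (canonicalCluster p q) := by
  induction p, hpq using cluster_induction with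
  | base =>
    rw [canonicalCluster_self]
    refine ⟨trivial, fun i j hi hj => ?_⟩
    rw [pos_nil] at hi hj
    omega
  | step p p' hp' hq ih =>
    have hpos : ∀ i, pos [p] i = if (i : ℕ) = p then (p : ℕ) + 1 else if (i : ℕ) = p + 1 then (p : ℕ)
        else i := fun i => by rw [pos_cons, pos_nil]
    have hmem : ∀ d ∈ canonicalCluster p' q, p' ≤ d ∧ d ≤ q := fun d => mem_canonicalCluster.1
    rw [canonicalCluster_cons hp' hq]
    refine ⟨ih.append ⟨trivial, fun i j hi hj => ?_⟩ hmem fun i j h1 h2 h3 => ?_, fun i j hi hj => ?_⟩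
    · rw [pos_nil] at hi hj
      omega
    · rw [hpos] at h1 h2
      rw [hpos j] at h2
      split_ifs at h1 h2 <;> omega
    · have e1 : pos (canonicalCluster p' q ++ [p]) p.succ = p := by
        refine pos_append_of_forall (by rw [hpos]; simp) fun d hd => ?_
        have := (hmem d hd).1
        rw [Fin.le_def] at this
        omega
      have e2 : pos (canonicalCluster p' q ++ [p]) p.castSucc = q + 1 := by
        rw [pos_append, pos, wordProd_canonicalCluster hq, wordProd_cons, wordProd_nil, mul_one,
          gen, Equiv.swap_apply_left]
        have : p.succ = p'.castSucc := Fin.ext hp'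
        rw [this, Equiv.swap_apply_left, Fin.val_succ]
      have e3 : ¬ pos [p] j ≤ p := by
        rw [← pos_append_le_iff (v := canonicalCluster p' q) (c := (p : ℕ)) (fun d hd => by
          have := (hmem d hd).1
          rw [Fin.le_def] at this; omega), hj]
        omega
      obtain rfl : i = p.succ := pos_inj.1 (hi.trans e1.symm)
      have e4 : j ≠ p.castSucc := by
        rintro rfl
        rw [e2] at hj
        rw [Fin.le_def] at hq
        omega
      rw [hpos] at e3
      rw [Ne, Fin.ext_iff, Fin.val_castSucc] at e4
      rw [Fin.lt_def, Fin.val_succ]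
      split_ifs at e3 <;> omega

theorem card_invSet_swap_le {A B : Fin (n + 1)} (h : A < B) :
    (invSet (Equiv.swap A B)).card + 1 ≤ 2 * ((B : ℕ) - A) := by
  rw [Fin.lt_def] at h
  have hle : (⟨A, by omega⟩ : Fin n) ≤ ⟨B - 1, by omega⟩ := by
    rw [Fin.le_def]; simp only; omega
  have h1 := card_invSet_le_length (canonicalCluster (⟨A, by omega⟩ : Fin n) ⟨B - 1, by omega⟩)
  have e : (⟨(B : ℕ) - 1, by omega⟩ : Fin n).succ = B := by
    ext; simp only [Fin.val_succ]; omega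
  rw [length_canonicalCluster hle, wordProd_canonicalCluster hle, e] at h1
  simp only [Fin.castSucc_mk, Fin.eta] at h1
  omega

/-! ### Words with marked braid clusters -/

/-- `u` is a word with some factors marked as braid clusters, of lengths `2 * m + 1` with sum of
the numbers `m` equal to `N`. -/
inductive Clustered : List (Fin n) → ℕ → Prop
  | nil : Clustered [] 0
  | cons {u : List (Fin n)} {N : ℕ} (b : Fin n) : Clustered u N → Clustered (b :: u) N
  | cluster {u c : List (Fin n)} {m N : ℕ} : IsBraidCluster m c → Clustered u N →
      Clustered (c ++ u) (m + N)

theorem Clustered.append_left (a : List (Fin n)) {u : List (Fin n)} {N : ℕ} (h : Clustered u N) :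
    Clustered (a ++ u) N := by
  induction a with
  | nil => exact h
  | cons b a ih => exact .cons b ih

theorem clustered_flatten {M : ℕ} (a : Fin (M + 1) → List (Fin n)) (c : Fin M → List (Fin n))
    (m : Fin M → ℕ) (h : ∀ j, IsBraidCluster (m j) (c j)) :
    Clustered (a 0 ++ (List.ofFn fun j : Fin M => c j ++ a j.succ).flatten) (∑ j, m j) := by
  induction M with
  | zero => simpa using Clustered.nil.append_left (a 0)
  | succ M ih =>
    rw [List.ofFn_succ, List.flatten_cons, Fin.sum_univ_succ, List.append_assoc]
    exact .append_left _ (.cluster (h 0) (ih (fun j => a j.succ) (fun j => c j.succ)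
      (fun j => m j.succ) fun j => h j.succ))

theorem Clustered.exists_flatten {u : List (Fin n)} {N : ℕ} (h : Clustered u N) :
    ∃ (M : ℕ) (a : Fin (M + 1) → List (Fin n)) (c : Fin M → List (Fin n)) (m : Fin M → ℕ),
      (∀ j, a j <:+: u) ∧ (∀ j, IsBraidCluster (m j) (c j)) ∧
      u = a 0 ++ (List.ofFn fun j : Fin M => c j ++ a j.succ).flatten ∧ N = ∑ j, m j := by
  induction h with
  | nil => exact ⟨0, fun _ => [], fun _ => [], fun _ => 0, by simp, fun j => j.elim0, by simp, by simp⟩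
  | @cons u N b _ ih =>
    obtain ⟨M, a, c, m, h1, h2, h3, h4⟩ := ih
    refine ⟨M, Fin.cons (b :: a 0) fun j => a j.succ, c, m, fun j => ?_, h2, ?_, h4⟩
    · refine Fin.cases ?_ (fun j => ?_) j
      · rw [Fin.cons_zero]
        conv_rhs => rw [h3]
        exact ⟨[], _, rfl⟩
      · rw [Fin.cons_succ]
        exact (h1 _).trans ⟨[b], [], by simp⟩
    · simp only [Fin.cons_zero, Fin.cons_succ, List.cons_append]
      rw [← h3]
  | @cluster u c₀ m₀ N hc _ ih =>
    obtain ⟨M, a, c, m, h1, h2, h3, h4⟩ := ih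
    refine ⟨M + 1, Fin.cons [] a, Fin.cons c₀ c, Fin.cons m₀ m, fun j => ?_, fun j => ?_, ?_, ?_⟩
    · refine Fin.cases ?_ (fun j => ?_) j
      · rw [Fin.cons_zero]
        exact List.nil_infix
      · rw [Fin.cons_succ]
        exact (h1 _).trans ⟨c₀, [], by simp⟩
    · refine Fin.cases ?_ (fun j => ?_) j
      · simpa using hc
      · simpa using h2 j
    · rw [List.ofFn_succ]
      simp only [Fin.cons_zero, Fin.cons_succ, List.nil_append, List.flatten_cons, List.append_assoc]
      rw [← h3]
    · rw [Fin.sum_univ_succ]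
      simp [h4]

/-! ### Maximally clustered permutations have isolated middles -/

/-- A braid cluster at the left of a reduced word contributes a family of instances of the pattern
321: two strings that change places in the cluster, and the strings between them. -/
theorem IsBraidCluster.exists_triples {m : ℕ} {c u : List (Fin n)} (hc : IsBraidCluster m c)
    (hr : RedWord (c ++ u)) :
    ∃ (x z : Fin (n + 1)) (Y : Finset (Fin (n + 1))), m ≤ Y.card ∧ ∀ y ∈ Y, x < y ∧ y < z ∧
      pos u x < pos u y ∧ pos u y < pos u z ∧
      pos (c ++ u) z < pos (c ++ u) y ∧ pos (c ++ u) y < pos (c ++ u) x := by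
  obtain ⟨hlen, A, B, hAB, hswap⟩ := hc.exists_swap
  have hred : RedWord c := by
    refine IsReduced.redWord (IsReduced.of_append (l := []) (r := u) ?_)
    simpa using hr.isReduced
  have hm : m + A + 1 ≤ B := by
    have h1 := redWord_iff_length.1 hred
    have h2 := card_invSet_swap_le hAB
    rw [Fin.lt_def] at hAB
    rw [hswap] at h1
    omega
  set v := wordProd u with hv
  have hpu : ∀ y, pos u (v⁻¹ y) = y := fun y => by simp [pos, hv]
  have hpc : ∀ y, pos (c ++ u) (v⁻¹ y) = Equiv.swap A B y := fun y => by
    rw [pos, wordProd_append, hswap, Equiv.Perm.mul_apply, ← hv, Equiv.Perm.inv_def,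
      Equiv.apply_symm_apply]
  refine ⟨v⁻¹ A, v⁻¹ B, (Finset.Ioo A B).image fun y => v⁻¹ y, ?_, ?_⟩
  · rw [Finset.card_image_of_injective _ v⁻¹.injective, Fin.card_Ioo]
    omega
  · intro y' hy'
    obtain ⟨y, hy, rfl⟩ := Finset.mem_image.1 hy'
    obtain ⟨hAy, hyB⟩ := Finset.mem_Ioo.1 hy
    have e1 : pos (c ++ u) (v⁻¹ A) = B := by rw [hpc, Equiv.swap_apply_left]
    have e2 : pos (c ++ u) (v⁻¹ B) = A := by rw [hpc, Equiv.swap_apply_right]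
    have e3 : pos (c ++ u) (v⁻¹ y) = y := by
      rw [hpc, Equiv.swap_apply_of_ne_of_ne hAy.ne' hyB.ne]
    rw [e1, e2, e3, hpu, hpu, hpu]
    rw [Fin.lt_def] at hAy hyB
    refine ⟨?_, ?_, hAy, hyB, hAy, hyB⟩
    · by_contra hcon
      have hne : v⁻¹ y ≠ v⁻¹ A := fun e => by
        have := v⁻¹.injective e; omega
      have := hr.pos_lt (lt_of_le_of_ne (not_lt.1 hcon) hne) (by rw [hpu, hpu]; exact hAy)
      rw [e1, e3] at this
      omega
    · by_contra hcon
      have hne : v⁻¹ B ≠ v⁻¹ y := fun e => by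
        have := v⁻¹.injective e; omega
      have := hr.pos_lt (lt_of_le_of_ne (not_lt.1 hcon) hne) (by rw [hpu, hpu]; exact hyB)
      rw [e2, e3] at this
      omega

/-- The instances of the pattern 321. -/
def triples (w : Equiv.Perm (Fin (n + 1))) : Finset (Fin (n + 1) × Fin (n + 1) × Fin (n + 1)) :=
  Finset.univ.filter fun t => t.1 < t.2.1 ∧ t.2.1 < t.2.2 ∧ w t.2.2 < w t.2.1 ∧ w t.2.1 < w t.1

theorem mem_triples {w : Equiv.Perm (Fin (n + 1))} {h i k : Fin (n + 1)} :
    (h, i, k) ∈ triples w ↔ h < i ∧ i < k ∧ w k < w i ∧ w i < w h := by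
  simp [triples]

theorem num321_eq (w : Equiv.Perm (Fin (n + 1))) : num321 w = (triples w).card :=
  Fintype.card_subtype _

/-- The braid clusters marked in a reduced word yield as many instances of the pattern 321 as their
lengths demand, and among these no two different ones have the first two or the last two entries in
common. -/
theorem Clustered.exists_triples {u : List (Fin n)} {N : ℕ} (h : Clustered u N) (hr : RedWord u) :
    ∃ T ⊆ triples (wordProd u), N ≤ T.card ∧
      (∀ x x' y z, (x, y, z) ∈ T → (x', y, z) ∈ T → x = x') ∧
      (∀ x y z z', (x, y, z) ∈ T → (x, y, z') ∈ T → z = z') := by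
  classical
  induction h with
  | nil => exact ⟨∅, by simp, by simp, by simp, by simp⟩
  | @cons u N b _ ih =>
    obtain ⟨T, hT, hN, h1, h2⟩ := ih hr.1
    refine ⟨T, ?_, hN, h1, h2⟩
    rintro ⟨x, y, z⟩ ht
    obtain ⟨hxy, hyz, hzy, hyx⟩ := mem_triples.1 (hT ht)
    have hr' : RedWord ([b] ++ u) := hr
    exact mem_triples.2 ⟨hxy, hyz, hr'.pos_lt hyz hzy, hr'.pos_lt hxy hyx⟩
  | @cluster u c m N hc _ ih =>
    obtain ⟨T, hT, hN, h1, h2⟩ := ih hr.of_append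
    obtain ⟨x₀, z₀, Y, hY, hYt⟩ := hc.exists_triples hr
    have hTlt : ∀ x y z, (x, y, z) ∈ T → x < y ∧ y < z ∧ pos u z < pos u y ∧ pos u y < pos u x :=
      fun x y z ht => mem_triples.1 (hT ht)
    have hnew : ∀ x y z, (x, y, z) ∈ Y.image (fun y => (x₀, y, z₀)) ↔ x = x₀ ∧ y ∈ Y ∧ z = z₀ := by
      intro x y z
      simp only [Finset.mem_image, Prod.mk.injEq]
      constructor
      · rintro ⟨a, ha, rfl, rfl, rfl⟩; exact ⟨rfl, ha, rfl⟩
      · rintro ⟨rfl, ha, rfl⟩; exact ⟨y, ha, rfl, rfl, rfl⟩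
    refine ⟨T ∪ Y.image (fun y => (x₀, y, z₀)), ?_, ?_, ?_, ?_⟩
    · rintro ⟨x, y, z⟩ ht
      rcases Finset.mem_union.1 ht with ht | ht
      · obtain ⟨hxy, hyz, hzy, hyx⟩ := hTlt x y z ht
        exact mem_triples.2 ⟨hxy, hyz, hr.pos_lt hyz hzy, hr.pos_lt hxy hyx⟩
      · obtain ⟨rfl, hy, rfl⟩ := (hnew x y z).1 ht
        obtain ⟨a1, a2, -, -, a3, a4⟩ := hYt y hy
        exact mem_triples.2 ⟨a1, a2, a3, a4⟩
    · rw [Finset.card_union_of_disjoint, Finset.card_image_of_injective]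
      · omega
      · exact fun a b hab => by simpa using hab
      · rw [Finset.disjoint_left]
        rintro ⟨x, y, z⟩ ht ht'
        obtain ⟨rfl, hy, rfl⟩ := (hnew x y z).1 ht'
        exact absurd (hTlt _ _ _ ht).2.2.2 (hYt y hy).2.2.1.not_gt
    · intro x x' y z hm hm'
      rcases Finset.mem_union.1 hm with ht | ht <;> rcases Finset.mem_union.1 hm' with ht' | ht'
      · exact h1 x x' y z ht ht'
      · obtain ⟨rfl, hy, rfl⟩ := (hnew _ _ _).1 ht'
        exact absurd (hTlt _ _ _ ht).2.2.1 (hYt y hy).2.2.2.1.not_gt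
      · obtain ⟨rfl, hy, rfl⟩ := (hnew _ _ _).1 ht
        exact absurd (hTlt _ _ _ ht').2.2.1 (hYt y hy).2.2.2.1.not_gt
      · exact ((hnew _ _ _).1 ht).1.trans ((hnew _ _ _).1 ht').1.symm
    · intro x y z z' hm hm'
      rcases Finset.mem_union.1 hm with ht | ht <;> rcases Finset.mem_union.1 hm' with ht' | ht'
      · exact h2 x y z z' ht ht'
      · obtain ⟨rfl, hy, rfl⟩ := (hnew _ _ _).1 ht'
        exact absurd (hTlt _ _ _ ht).2.2.2 (hYt y hy).2.2.1.not_gt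
      · obtain ⟨rfl, hy, rfl⟩ := (hnew _ _ _).1 ht
        exact absurd (hTlt _ _ _ ht').2.2.2 (hYt y hy).2.2.1.not_gt
      · exact ((hnew _ _ _).1 ht).2.2.trans ((hnew _ _ _).1 ht').2.2.symm

/-- An entry with exactly one larger entry to its left and one smaller entry to its right is a fixed
point. -/
theorem apply_eq_of_unique {w : Equiv.Perm (Fin (n + 1))} {h i k : Fin (n + 1)} (hh : h < i)
    (hk : i < k) (hhi : w i < w h) (hki : w k < w i) (h1 : ∀ h' < i, w i < w h' → h' = h)
    (h2 : ∀ k' > i, w k' < w i → k' = k) : w i = i := by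
  have e1 : ((Finset.univ.filter fun j => w j < w i).erase k) = (Finset.Iio i).erase h := by
    ext j
    simp only [Finset.mem_erase, Finset.mem_filter, Finset.mem_univ, true_and, Finset.mem_Iio]
    constructor
    · rintro ⟨hjk, hj⟩
      have hji : j ≠ i := by rintro rfl; exact lt_irrefl _ hj
      have hlt : j < i := by
        by_contra hcon
        exact hjk (h2 j (lt_of_le_of_ne (not_lt.1 hcon) hji.symm) hj)
      exact ⟨by rintro rfl; exact absurd hj hhi.not_gt, hlt⟩
    · rintro ⟨hjh, hj⟩
      refine ⟨by rintro rfl; exact absurd hj hk.not_gt, ?_⟩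
      by_contra hcon
      exact hjh (h1 j hj (lt_of_le_of_ne (not_lt.1 hcon) fun e => hj.ne (w.injective e).symm))
  have e2 : (Finset.univ.filter fun j => w j < w i).card = w i := by
    have : (Finset.univ.filter fun j => w j < w i) = (Finset.Iio (w i)).map w.symm.toEmbedding := by
      ext j
      simp
    rw [this, Finset.card_map, Fin.card_Iio]
  have e3 := congrArg Finset.card e1
  have hk' : k ∈ Finset.univ.filter fun j => w j < w i := by simpa using hki
  rw [Finset.card_erase_of_mem hk', Finset.card_erase_of_mem (by simpa using hh),
    e2, Fin.card_Iio] at e3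
  rw [Fin.lt_def] at hki hh
  ext
  omega

theorem IsMaximallyClustered.star {w : Equiv.Perm (Fin (n + 1))} (h : IsMaximallyClustered w) :
    Star w := by
  obtain ⟨M, a, c, m, -, hc, ⟨hred, hw⟩, hnum⟩ := h
  obtain ⟨T, hT, hN, h1, h2⟩ := (clustered_flatten a c m hc).exists_triples hred.redWord
  rw [hw] at hT
  rw [← hnum, num321_eq] at hN
  -- the number of instances leaves no room for any that does not come from a cluster
  have hTe := Finset.eq_of_subset_of_card_le hT hN
  rw [hTe] at h1 h2
  intro x y z hxy hyz hx hz
  have ht : (x, y, z) ∈ triples w := mem_triples.2 ⟨hxy, hyz, hz, hx⟩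
  have f1 : ∀ x' < y, w y < w x' → x' = x := fun x' hx' hlt =>
    h1 x' x y z (mem_triples.2 ⟨hx', hyz, hz, hlt⟩) ht
  have f2 : ∀ z' > y, w z' < w y → z' = z := fun z' hz' hlt =>
    h2 x y z' z (mem_triples.2 ⟨hxy, hz', hlt, hx⟩) ht
  exact ⟨apply_eq_of_unique hxy hyz hx hz f1 f2, f1, f2⟩

/-! ### Permutations with isolated middles are maximally clustered -/

/-- The entry at `i` is the middle entry of an instance of the pattern 321. -/
def IsMiddle (w : Equiv.Perm (Fin (n + 1))) (i : Fin (n + 1)) : Prop :=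
  ∃ h k, h < i ∧ i < k ∧ w i < w h ∧ w k < w i

theorem Star.apply_eq {w : Equiv.Perm (Fin (n + 1))} (hs : Star w) {i : Fin (n + 1)}
    (hi : IsMiddle w i) : w i = i := by
  obtain ⟨h, k, h1, h2, h3, h4⟩ := hi
  exact (hs h i k h1 h2 h3 h4).1

theorem IsMiddle.inv {w : Equiv.Perm (Fin (n + 1))} {i : Fin (n + 1)} (h : IsMiddle w i) :
    IsMiddle w⁻¹ (w i) := by
  obtain ⟨h, k, h1, h2, h3, h4⟩ := h
  exact ⟨w k, w h, h4, h3, by simpa using h2, by simpa using h1⟩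

theorem Star.inv {w : Equiv.Perm (Fin (n + 1))} (hs : Star w) : Star w⁻¹ := by
  intro h i k h1 h2 h3 h4
  obtain ⟨e1, e2, e3⟩ := hs (w⁻¹ k) (w⁻¹ i) (w⁻¹ h) h4 h3 (by simpa using h2) (by simpa using h1)
  rw [Equiv.Perm.inv_def, Equiv.apply_symm_apply] at e1
  refine ⟨e1.symm, fun h' hh' hlt => ?_, fun k' hk' hlt => ?_⟩
  · exact w⁻¹.injective (e3 (w⁻¹ h') hlt (by simpa using hh'))
  · exact w⁻¹.injective (e2 (w⁻¹ k') hlt (by simpa using hk'))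

theorem card_triples_le {w : Equiv.Perm (Fin (n + 1))} (hs : Star w) :
    (triples w).card ≤ Set.ncard {i | IsMiddle w i} := by
  classical
  rw [Set.ncard_eq_toFinset_card']
  refine Finset.card_le_card_of_injOn (fun t => t.2.1) ?_ ?_
  · rintro ⟨h, i, k⟩ ht
    obtain ⟨h1, h2, h3, h4⟩ := mem_triples.1 ht
    simpa using ⟨h, k, h1, h2, h4, h3⟩
  · rintro ⟨h, i, k⟩ ht ⟨h', i', k'⟩ ht' (rfl : i = i')
    obtain ⟨h1, h2, h3, h4⟩ := mem_triples.1 ht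
    obtain ⟨h1', h2', h3', h4'⟩ := mem_triples.1 ht'
    obtain ⟨-, e1, e2⟩ := hs h i k h1 h2 h4 h3
    rw [e1 h' h1' h4', e2 k' h2' h3']

/-- On an interval without descents a permutation stretches distances. -/
theorem add_le_add_of_forall_lt {σ : Equiv.Perm (Fin (n + 1))} {x y : ℕ}
    (h : ∀ b : Fin n, x ≤ b → (b : ℕ) + 1 ≤ y → σ b.castSucc < σ b.succ) (i j : Fin (n + 1))
    (hi : x ≤ i) (hij : i ≤ j) (hj : j ≤ y) : (σ i : ℕ) + j ≤ σ j + i := by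
  obtain ⟨j, hjn⟩ := j
  rw [Fin.le_def] at hij
  simp only at hij hj ⊢
  induction j, hij using Nat.le_induction with
  | base => exact le_rfl
  | succ j hij ih =>
    have h1 := ih (by omega) (by omega)
    have h2 := h ⟨j, by omega⟩ (by simp only; omega) hj
    rw [Fin.lt_def] at h2
    simp only [Fin.castSucc_mk, Fin.succ_mk] at h2
    omega

/-- If each descent of `σ` involves a middle, then some middles fill the gap between two positions
`x` and `z`: take an instance of the pattern 321 with outer entries as close together as
possible. -/
theorem Star.exists_interval {σ : Equiv.Perm (Fin (n + 1))} (hs : Star σ)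
    (hd : ∀ b : Fin n, σ b.succ < σ b.castSucc → IsMiddle σ b.castSucc ∨ IsMiddle σ b.succ)
    (hm : ∃ i, IsMiddle σ i) :
    ∃ x z : Fin (n + 1), (x : ℕ) + 2 ≤ z ∧ σ z ≤ x ∧ z ≤ σ x ∧
      ∀ i, x < i → i < z → σ i = i := by
  classical
  obtain ⟨x, y, z, ⟨hxy, hyz, hyx, hzy⟩, hmin⟩ : ∃ x y z, (x < y ∧ y < z ∧ σ y < σ x ∧ σ z < σ y) ∧
      ∀ x' y' z', x' < y' → y' < z' → σ y' < σ x' → σ z' < σ y' → (z : ℕ) - x ≤ z' - x' := by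
    have hex : ∃ d x y z, (x < y ∧ y < z ∧ σ y < σ x ∧ σ z < σ y) ∧ (z : ℕ) - x = d := by
      obtain ⟨y, x, z, h1, h2, h3, h4⟩ := hm
      exact ⟨_, x, y, z, ⟨h1, h2, h3, h4⟩, rfl⟩
    obtain ⟨x, y, z, h, hd⟩ := Nat.find_spec hex
    refine ⟨x, y, z, h, fun x' y' z' h1 h2 h3 h4 => ?_⟩
    rw [hd]
    exact Nat.find_min' hex ⟨x', y', z', ⟨h1, h2, h3, h4⟩, rfl⟩
  obtain ⟨hy, hux, huz⟩ := hs x y z hxy hyz hyx hzy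
  have hfix : ∀ i, IsMiddle σ i → (σ i : ℕ) = i := fun i hi => by rw [hs.apply_eq hi]
  simp only [Fin.lt_def] at hxy hyz hyx hzy
  have hy' : (σ y : ℕ) = y := by rw [hy]
  -- descents between `x` and `z` occur only at the ends
  have hdesc : ∀ b : Fin n, (x : ℕ) ≤ b → (b : ℕ) + 1 ≤ z → σ b.succ < σ b.castSucc →
      ((b : ℕ) = x ∧ IsMiddle σ b.succ) ∨ ((b : ℕ) + 1 = z ∧ IsMiddle σ b.castSucc) := by
    intro b hxb hbz hb
    rcases hd b hb with hmid | hmid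
    · right
      refine ⟨?_, hmid⟩
      have hb' := hfix _ hmid
      obtain ⟨x', z', h1, h2, h3, h4⟩ := hmid
      obtain ⟨-, ux, -⟩ := hs x' b.castSucc z' h1 h2 h3 h4
      have hmin' := hmin x' b.castSucc b.succ h1 Fin.castSucc_lt_succ h3 hb
      have hxne : (x : ℕ) ≠ b := fun e => by
        have : x = b.castSucc := Fin.ext e
        rw [this] at hyx
        simp only [Fin.val_castSucc] at hb'
        omega
      rw [Fin.lt_def] at h1 h3
      simp only [Fin.val_castSucc, Fin.val_succ] at h1 h3 hb' hmin'
      by_cases hxx : (b : ℕ) < σ x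
      · rw [← ux x (by rw [Fin.lt_def, Fin.val_castSucc]; omega) (by rw [Fin.lt_def]; omega)] at hmin'
        omega
      · exfalso
        by_cases hx'y : (x' : ℕ) < y
        · have := hux x' hx'y (by rw [Fin.lt_def]; omega)
          rw [this] at h3
          omega
        · omega
    · left
      refine ⟨?_, hmid⟩
      have hb' := hfix _ hmid
      obtain ⟨x', z', h1, h2, h3, h4⟩ := hmid
      obtain ⟨-, -, uz⟩ := hs x' b.succ z' h1 h2 h3 h4
      have hmin' := hmin b.castSucc b.succ z' Fin.castSucc_lt_succ h2 hb h4
      have hzne : (z : ℕ) ≠ b + 1 := fun e => by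
        have : z = b.succ := Fin.ext e
        rw [this] at hzy
        simp only [Fin.val_succ] at hb'
        omega
      rw [Fin.lt_def] at h2 h4
      simp only [Fin.val_castSucc, Fin.val_succ] at h2 h4 hb' hmin'
      by_cases hzz : (σ z : ℕ) < b + 1
      · rw [← uz z (by rw [gt_iff_lt, Fin.lt_def, Fin.val_succ]; omega)
          (by rw [Fin.lt_def]; omega)] at hmin'
        omega
      · exfalso
        by_cases hz'y : (y : ℕ) < z'
        · have := huz z' hz'y (by rw [Fin.lt_def]; omega)
          rw [this] at h4
          omega
        · omega
  have hasc : ∀ b : Fin n, (x : ℕ) ≤ b → (b : ℕ) + 1 ≤ z → ¬ σ b.succ < σ b.castSucc →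
      σ b.castSucc < σ b.succ := fun b _ _ h =>
    lt_of_le_of_ne (not_lt.1 h) fun e => Fin.castSucc_lt_succ.ne (σ.injective e)
  have hmono := add_le_add_of_forall_lt (σ := σ) (x := x + 1) (y := z - 1) (fun b h1 h2 =>
    hasc b (by omega) (by omega) fun hb => by
      rcases hdesc b (by omega) (by omega) hb with h | h <;> omega)
  -- both ends are descents, since `y` lies below `x` and above `z`
  have hx1 : (σ ⟨x + 1, by omega⟩ : ℕ) = x + 1 ∧ (x : ℕ) + 1 < σ x := by
    have hb : σ (⟨x, by omega⟩ : Fin n).succ < σ (⟨x, by omega⟩ : Fin n).castSucc := by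
      by_contra hcon
      have h1 := hasc ⟨x, by omega⟩ le_rfl (by simp only; omega) hcon
      have h2 := hmono ⟨x + 1, by omega⟩ y le_rfl (by rw [Fin.le_def]; simp only; omega) (by omega)
      rw [Fin.lt_def] at h1
      simp only [Fin.castSucc_mk, Fin.succ_mk, Fin.eta] at h1 h2
      omega
    rcases hdesc ⟨x, by omega⟩ le_rfl (by simp only; omega) hb with ⟨-, h⟩ | ⟨h, -⟩
    · have := hfix _ h
      rw [Fin.lt_def] at hb
      simp only [Fin.succ_mk, Fin.castSucc_mk, Fin.eta] at this hb
      omega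
    · simp only at h; omega
  have hz1 : (σ ⟨z - 1, by omega⟩ : ℕ) = z - 1 ∧ (σ z : ℕ) < z - 1 := by
    have e : (⟨(z : ℕ) - 1, by omega⟩ : Fin n).succ = z := by
      ext; simp only [Fin.val_succ]; omega
    have hb : σ (⟨z - 1, by omega⟩ : Fin n).succ < σ (⟨z - 1, by omega⟩ : Fin n).castSucc := by
      by_contra hcon
      have h1 := hasc ⟨z - 1, by omega⟩ (by simp only; omega) (by simp only; omega) hcon
      have h2 := hmono y ⟨z - 1, by omega⟩ (by omega) (by rw [Fin.le_def]; simp only; omega)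
        (by simp only; omega)
      rw [Fin.lt_def, e] at h1
      simp only [Fin.castSucc_mk] at h1 h2
      omega
    rcases hdesc ⟨z - 1, by omega⟩ (by simp only; omega) (by simp only; omega) hb with ⟨h, -⟩ | ⟨-, h⟩
    · simp only at h; omega
    · have := hfix _ h
      rw [Fin.lt_def, e] at hb
      simp only [Fin.castSucc_mk] at this hb
      omega
  have hall : ∀ i, x < i → i < z → σ i = i := by
    intro i hxi hiz
    rw [Fin.lt_def] at hxi hiz
    have h1 := hmono ⟨x + 1, by omega⟩ i le_rfl (by rw [Fin.le_def]; simp only; omega) (by omega)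
    have h2 := hmono i ⟨z - 1, by omega⟩ (by omega) (by rw [Fin.le_def]; simp only; omega)
      (by simp only; omega)
    simp only at h1 h2
    ext
    omega
  refine ⟨x, z, by omega, ?_, ?_, hall⟩
  · by_contra hcon
    have := σ.injective (hall (σ z) (not_le.1 hcon) (by rw [Fin.lt_def]; omega))
    rw [this] at hz1
    omega
  · by_contra hcon
    have := σ.injective (hall (σ x) (by rw [Fin.lt_def]; omega) (not_le.1 hcon))
    rw [this] at hx1
    omega

theorem Star.of_append {v u : List (Fin n)} (hr : RedWord (v ++ u))
    (hs : Star (wordProd (v ++ u))) : Star (wordProd u) := by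
  induction v with
  | nil => exact hs
  | cons b v ih => exact ih hr.1 (Star.of_cons hr hs)

/-- A permutation with isolated middles has a reduced word in which clusters account for all
middles. -/
theorem Star.exists_clustered {w : Equiv.Perm (Fin (n + 1))} (hs : Star w) :
    ∃ u N, Clustered u N ∧ RedWord u ∧ wordProd u = w ∧ Set.ncard {i | IsMiddle w i} ≤ N := by
  induction hN : (invSet w).card using Nat.strong_induction_on generalizing w with
  | _ N ih =>
    -- a descent whose two strings are not middles can be split off without affecting any middle
    by_cases hfree : ∃ b : Fin n, w⁻¹ b.succ < w⁻¹ b.castSucc ∧ ¬ IsMiddle w⁻¹ b.castSucc ∧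
        ¬ IsMiddle w⁻¹ b.succ
    · obtain ⟨b, hb, hb1, hb2⟩ := hfree
      have hcard := card_invSet_gen_mul_add hb
      have hwb : gen b * (gen b * w) = w := by rw [← mul_assoc, gen_mul_self, one_mul]
      have hred : ∀ u, RedWord u → wordProd u = gen b * w → RedWord (b :: u) := by
        intro u hu huw
        rw [redWord_cons_iff]
        refine ⟨hu, ?_⟩
        rw [huw]
        simpa [mul_inv_rev, gen, Equiv.Perm.mul_apply] using hb
      obtain ⟨u₁, hu₁, huw₁⟩ := exists_good (gen b * w)
      have hs' : Star (gen b * w) := by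
        rw [← huw₁]
        refine Star.of_cons (hred u₁ hu₁.redWord huw₁) ?_
        rwa [wordProd_cons, huw₁, hwb]
      obtain ⟨u, N', hc, hr, huw, hmid⟩ := ih _ (by omega) hs' rfl
      refine ⟨b :: u, N', .cons b hc, hred u hr huw, by rw [wordProd_cons, huw, hwb], ?_⟩
      refine (Set.ncard_le_ncard ?_ (Set.toFinite _)).trans hmid
      intro i hi
      have hii := hs.apply_eq hi
      have hinv := hi.inv
      rw [hii] at hinv
      have n1 : (i : ℕ) ≠ b := fun e => hb1 (by
        rwa [show b.castSucc = i from Fin.ext e.symm])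
      have n2 : (i : ℕ) ≠ b + 1 := fun e => hb2 (by
        rwa [show b.succ = i from Fin.ext e.symm])
      obtain ⟨h, k, h1, h2, h3, h4⟩ := hi
      refine ⟨h, k, h1, h2, ?_, ?_⟩
      · rw [Fin.lt_def, Equiv.Perm.mul_apply, Equiv.Perm.mul_apply, gen_val, gen_val]
        rw [hii] at h3 ⊢
        rw [Fin.lt_def] at h3
        split_ifs <;> omega
      · rw [Fin.lt_def, Equiv.Perm.mul_apply, Equiv.Perm.mul_apply, gen_val, gen_val]
        rw [hii] at h4 ⊢
        rw [Fin.lt_def] at h4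
        split_ifs <;> omega
    · have hd : ∀ b : Fin n, w⁻¹ b.succ < w⁻¹ b.castSucc →
          IsMiddle w⁻¹ b.castSucc ∨ IsMiddle w⁻¹ b.succ := fun b hb => by
        by_contra hcon
        rw [not_or] at hcon
        exact hfree ⟨b, hb, hcon⟩
      by_cases hm : ∃ i, IsMiddle w⁻¹ i
      · obtain ⟨x, z, hxz, hz, hx, hall⟩ := hs.inv.exists_interval hd hm
        have hpq : (⟨x, by omega⟩ : Fin n) < ⟨z - 1, by omega⟩ := by
          rw [Fin.lt_def]; simp only; omega
        set p : Fin n := ⟨x, by omega⟩ with hp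
        set q : Fin n := ⟨z - 1, by omega⟩ with hq
        have hpx : p.castSucc = x := rfl
        have hqz : q.succ = z := by ext; simp only [Fin.val_succ, hq]; omega
        have hwp := wordProd_canonicalCluster hpq.le
        rw [hpx, hqz] at hwp
        have hww : Equiv.swap x z * (Equiv.swap x z * w) = w := Equiv.swap_mul_self_mul x z w
        have hred : ∀ u, RedWord u → wordProd u = Equiv.swap x z * w →
            RedWord (canonicalCluster p q ++ u) := by
          intro u hu huw
          refine (redWord_canonicalCluster hpq.le).append hu (fun d => mem_canonicalCluster.1)
            fun i j h1 h2 h3 => ?_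
          have hval : ∀ j, (pos u j = x → j = w⁻¹ z) ∧ (pos u j = z → j = w⁻¹ x) ∧
              (∀ a : Fin (n + 1), x < a → a < z → pos u j = a → j = a) := by
            intro j
            have hj : ∀ a, pos u j = (a : Fin (n + 1)) → j = w⁻¹ (Equiv.swap x z a) := by
              intro a ha
              rw [pos_eq_iff, huw, mul_inv_rev, Equiv.swap_inv, Equiv.Perm.mul_apply] at ha
              exact ha
            refine ⟨fun h => ?_, fun h => ?_, fun a h1 h2 h => ?_⟩
            · rw [hj x h, Equiv.swap_apply_left]
            · rw [hj z h, Equiv.swap_apply_right]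
            · rw [hj a h, Equiv.swap_apply_of_ne_of_ne h1.ne' h2.ne, hall a h1 h2]
          have hq' : (q : ℕ) + 1 = z := by simp only [hq]; omega
          have hp' : (p : ℕ) = x := rfl
          rw [Fin.le_def] at hz hx
          -- the strings enter at levels at most `x`, equal to the present one, at least `z`
          have hi' : (i : ℕ) ≤ pos u i := by
            by_cases hix : pos u i = x
            · rw [hix, (hval i).1 hix]; exact hz
            · have := (hval i).2.2 ⟨pos u i, by omega⟩ (by rw [Fin.lt_def]; simp only; omega)
                (by rw [Fin.lt_def]; simp only; omega) rfl
              exact (Fin.ext_iff.1 this).le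
          have hj' : pos u j ≤ j := by
            by_cases hjz : pos u j = z
            · rw [hjz, (hval j).2.1 hjz]; exact hx
            · have := (hval j).2.2 ⟨pos u j, by omega⟩ (by rw [Fin.lt_def]; simp only; omega)
                (by rw [Fin.lt_def]; simp only; omega) rfl
              exact (Fin.ext_iff.1 this).ge
          rw [Fin.lt_def]
          omega
        obtain ⟨u₁, hu₁, huw₁⟩ := exists_good (Equiv.swap x z * w)
        have hr₁ := hred u₁ hu₁.redWord huw₁
        have hs' : Star (Equiv.swap x z * w) := by
          rw [← huw₁]
          refine Star.of_append hr₁ ?_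
          rwa [wordProd_append, huw₁, hwp, hww]
        have hcard : (invSet (Equiv.swap x z * w)).card < N := by
          have h1 := redWord_iff_length.1 hr₁
          have h2 := redWord_iff_length.1 hu₁.redWord
          rw [wordProd_append, huw₁, hwp, hww, hN, List.length_append,
            length_canonicalCluster hpq.le] at h1
          rw [huw₁] at h2
          omega
        obtain ⟨u, N', hc, hr, huw, hmid⟩ := ih _ hcard hs' rfl
        refine ⟨canonicalCluster p q ++ u, _, .cluster (isBraidCluster_canonicalCluster hpq) hc,
          hred u hr huw, by rw [wordProd_append, huw, hwp, hww], ?_⟩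
        have hsub : {i | IsMiddle w i} ⊆
            (Finset.Ioo x z : Set (Fin (n + 1))) ∪ {i | IsMiddle (Equiv.swap x z * w) i} := by
          intro i hi
          by_cases hin : x < i ∧ i < z
          · exact Or.inl (by simpa using hin)
          · right
            have hii := hs.apply_eq hi
            have hii' : w⁻¹ i = i := by rw [Equiv.Perm.inv_eq_iff_eq, hii]
            have n1 : i ≠ x := by
              rintro rfl
              rw [hii'] at hx
              rw [Fin.le_def] at hx
              omega
            have n2 : i ≠ z := by
              rintro rfl
              rw [hii'] at hz
              rw [Fin.le_def] at hz
              omega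
            obtain ⟨h, k, h1, h2, h3, h4⟩ := hi
            refine ⟨h, k, h1, h2, ?_, ?_⟩
            · rw [Equiv.Perm.mul_apply, Equiv.Perm.mul_apply, hii,
                Equiv.swap_apply_of_ne_of_ne n1 n2, Equiv.swap_apply_def]
              rw [hii] at h3
              split_ifs <;> omega
            · rw [Equiv.Perm.mul_apply, Equiv.Perm.mul_apply, hii,
                Equiv.swap_apply_of_ne_of_ne n1 n2, Equiv.swap_apply_def]
              rw [hii] at h4
              split_ifs <;> omega
        refine (Set.ncard_le_ncard hsub (Set.toFinite _)).trans ((Set.ncard_union_le _ _).trans ?_)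
        rw [Set.ncard_coe_finset, Fin.card_Ioo]
        simp only [hp, hq]
        omega
      · -- without descents the permutation is the identity
        obtain ⟨u, hu, huw⟩ := exists_good w
        refine ⟨u, 0, ?_, hu.redWord, huw, ?_⟩
        · simpa using Clustered.nil.append_left u
        · refine le_of_eq ((Set.ncard_eq_zero (Set.toFinite _)).2 ?_)
          rw [Set.eq_empty_iff_forall_notMem]
          exact fun i hi => hm ⟨_, IsMiddle.inv hi⟩

theorem Star.isMaximallyClustered {w : Equiv.Perm (Fin (n + 1))} (hs : Star w) :
    IsMaximallyClustered w := by
  obtain ⟨u, N, hc, hr, huw, hmid⟩ := hs.exists_clustered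
  obtain ⟨T, hT, hTN, -, -⟩ := hc.exists_triples hr
  have hnum : num321 w = N := by
    rw [num321_eq]
    refine le_antisymm ((card_triples_le hs).trans hmid) (hTN.trans ?_)
    rw [← huw]
    exact Finset.card_le_card hT
  obtain ⟨M, a, c, m, h1, h2, h3, h4⟩ := hc.exists_flatten
  refine ⟨M, a, c, m, fun j => ?_, h2, ?_, by rw [hnum, h4]⟩
  · obtain ⟨l, r, hlr⟩ := h1 j
    exact IsReduced.of_append (l := l) (r := r) (by rw [hlr]; exact hr.isReduced)
  · rw [← h3]
    exact ⟨hr.isReduced, huw⟩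

end MaxClustered

theorem proposition1 (n : ℕ) :
    (∀ w : Equiv.Perm (Fin (n + 1)), MaxClustered.IsMaximallyClustered w →
      ∃! C : Set (List (Fin n)),
        MaxClustered.IsCommClassOf C w ∧ MaxClustered.ClassHasDecomposition C) ∧
    (∀ u : List (Fin n), MaxClustered.HeapHasDecomposition u →
      MaxClustered.IsReduced u ∧ MaxClustered.IsMaximallyClustered (MaxClustered.wordProd u)) := by
  open MaxClustered in
  refine ⟨fun w hw => ?_, fun u hu => ?_⟩
  · have hs := hw.star
    obtain ⟨u, hu, rfl⟩ := exists_good w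
    refine ⟨commClass u, ⟨⟨u, ⟨hu.redWord.isReduced, rfl⟩, rfl⟩, u, .refl,
      (hu.nested hs).heapHasDecomposition⟩, ?_⟩
    rintro C ⟨⟨v, ⟨-, hv⟩, rfl⟩, v', hvv', hdec⟩
    have hv' : wordProd v' = wordProd u := (commEquiv_wordProd hvv').symm.trans hv
    exact (commClass_eq hvv').trans (commClass_eq (hdec.nested.good.commEquiv hu hv'))
  · exact ⟨hu.nested.good.redWord.isReduced, hu.nested.star.isMaximallyClustered⟩
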